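/- Let $\mathbb K$ be an algebraically closed field of characteristic $p>0$, let $q=p^k$ with $k\ge 1$, and let $c\in\mathbb K$, $c\neq 0$. Let $\mathcal C\subset PG(2,\mathbb K)$ be the Artin–Schreier–Mumford curve in its plane model, that is, the irreducible curve with equation $(X_1^q+X_1X_3^{q-1})(X_2^q+X_2X_3^{q-1})=cX_3^{2q}$. Let $\tau=(X_1X_3:X_2X_3:X_1X_2:X_3^2)$, and let $\mathcal Y\subset PG(3,\mathbb K)$ be the Zariski closure of the image under $\tau$ of the points of $\mathcal C$ at which the four forms are not all zero. Then $\mathcal Y$ is an irreducible projective curve, $\tau$ is a birational map from $\mathcal C$ to $\mathcal Y$, and $\mathcal Y$ is nonsingular of degree $2q$. Assume moreover that $q\ge 5$. Then: (a) $\mathcal Y$ (with respect to its plane sections) is non-classical, with order sequence $(0,1,2,q)$. Likewise, the linear series cut out on $\mathcal C$ by the conics $a_1X_1X_3+a_2X_2X_3+a_3X_1X_2+a_4X_3^2=0$, i.e. the conics through $(1:0:0)$ and $(0:1:0)$, is non-classical with order sequence $(0,1,2,q)$. (b) If $c\in\mathbb F_q$, then $\mathcal Y$ (with respect to its plane sections)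 is defined over $\mathbb F_{q^2}$ and Frobenius non-classical over $\mathbb F_{q^2}$, with Frobenius order sequence $(0,1,q)$. The same holds for $\mathcal C$ with respect to the linear series of conics in (a). Here, for a curve with function field $F$ and a linear series cut out by forms $F_0,\dots,F_r$ of the same degree, let $f_0,\dots,f_r\in F$ be the corresponding rational functions, and let $D^{(i)}$ be the Hasse derivatives with respect to a separating variable of $F$. The order sequence is the lexicographically smallest sequence $\epsilon_0<\dots<\epsilon_r$ such that $\det(D^{(\epsilon_i)}f_j)\neq0$, and the series is non-classical if this sequence is not $(0,1,\dots,r)$. If the curve and the forms are defined over $\mathbb F_Q$, the Frobenius order sequence over $\mathbb F_Q$ is the lexicographically smallest sequence $\nu_0<\dots<\nu_{r-1}$ such that the determinant with rows $(f_0^Q,\dots,f_r^Q)$ and $(D^{(\nu_i)}f_0,\dots,D^{(\nu_i)}f_r)$, $0\le i\le r-1$, is not zero, and the series is Frobenius non-classical if this sequence is not $(0,1,\dots,r-1)$. -/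

import Mathlib

open scoped LinearAlgebra.Projectivization IntermediateField
open MvPolynomial

/-! Projective algebraic sets in `PG(n, K)`, for an (infinite) field `K`. -/

/-- The points of `PG(n, K)`. -/
abbrev PG (K : Type*) [Field K] (n : ℕ) : Type _ := ℙ K (Fin (n + 1) → K)

/-- The points of `PG(n, K)` at which all polynomials of `S` vanish (at every choice of
homogeneous coordinates of the point). -/
def projZeroLocus {K : Type*} [Field K] {n : ℕ} (S : Set (MvPolynomial (Fin (n + 1)) K)) :
    Set (PG K n) :=
  {P | ∀ (v : Fin (n + 1) → K) (hv : v ≠ 0), Projectivization.mk K v hv = P →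
    ∀ f ∈ S, eval v f = 0}

/-- The homogeneous ideal of a set of points of `PG(n, K)`: all polynomials that vanish on the
affine cone over it. -/
def projIdeal {K : Type*} [Field K] {n : ℕ} (Y : Set (PG K n)) :
    Ideal (MvPolynomial (Fin (n + 1)) K) where
  carrier := {f | ∀ (v : Fin (n + 1) → K) (hv : v ≠ 0), Projectivization.mk K v hv ∈ Y →
    eval v f = 0}
  add_mem' := by
    intro f g hf hg v hv hY
    rw [map_add, hf v hv hY, hg v hv hY, add_zero]
  zero_mem' := by
    intro v hv hY
    exact map_zero _
  smul_mem' := by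
    intro a f hf v hv hY
    rw [smul_eq_mul, map_mul, hf v hv hY, mul_zero]

/-- The Zariski closure of a set of points of `PG(n, K)`. -/
def projClosure {K : Type*} [Field K] {n : ℕ} (Y : Set (PG K n)) : Set (PG K n) :=
  projZeroLocus (projIdeal Y : Set (MvPolynomial (Fin (n + 1)) K))

/-- The set of the points `(F_0(P) : ... : F_m(P))`, for `P` in `Y` with `F_0, ..., F_m` not all
zero at `P`. -/
def projImage {K : Type*} [Field K] {n m : ℕ}
    (F : Fin (m + 1) → MvPolynomial (Fin (n + 1)) K) (Y : Set (PG K n)) : Set (PG K m) :=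
  {R | ∃ (v : Fin (n + 1) → K) (hv : v ≠ 0) (hF : (fun i => eval v (F i)) ≠ 0),
    Projectivization.mk K v hv ∈ Y ∧ R = Projectivization.mk K (fun i => eval v (F i)) hF}

/-- An irreducible projective curve in `PG(n, K)`: a Zariski closed set whose homogeneous ideal is
prime and whose affine cone has dimension two. -/
structure ProjCurve (K : Type*) [Field K] (n : ℕ) where
  carrier : Set (PG K n)
  closed : projClosure carrier = carrier
  prime : (projIdeal carrier).IsPrime
  dim_one : Algebra.trdeg K (MvPolynomial (Fin (n + 1)) K ⧸ projIdeal carrier) = 2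

namespace ProjCurve

variable {K : Type*} [Field K] {n m r : ℕ}

/-- The homogeneous ideal of the curve. -/
abbrev ideal (C : ProjCurve K n) : Ideal (MvPolynomial (Fin (n + 1)) K) := projIdeal C.carrier

instance (C : ProjCurve K n) : C.ideal.IsPrime := C.prime

/-- The homogeneous coordinate ring of the curve. -/
abbrev CoordRing (C : ProjCurve K n) : Type _ := MvPolynomial (Fin (n + 1)) K ⧸ C.ideal

/-- The field of fractions of the homogeneous coordinate ring. -/
abbrev ConeField (C : ProjCurve K n) : Type _ := FractionRing C.CoordRing

/-- The image of the `i`-th homogeneous coordinate in the field of fractions of the homogeneous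
coordinate ring. -/
noncomputable def homCoord (C : ProjCurve K n) (i : Fin (n + 1)) : C.ConeField :=
  algebraMap C.CoordRing C.ConeField (Ideal.Quotient.mk C.ideal (X i))

/-- The function field `K(C)`, generated over `K` by the quotients of homogeneous coordinates. -/
noncomputable def functionField (C : ProjCurve K n) : IntermediateField K C.ConeField :=
  IntermediateField.adjoin K
    (Set.range fun ij : Fin (n + 1) × Fin (n + 1) => C.homCoord ij.1 / C.homCoord ij.2)

/-- The rational function `X_i / X_j` on the curve. It is meaningful when `X_j` does not vanish
identically on the curve. -/
noncomputable def ratio (C : ProjCurve K n) (i j : Fin (n + 1)) : C.functionField :=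
  ⟨C.homCoord i / C.homCoord j, IntermediateField.subset_adjoin K _ ⟨(i, j), rfl⟩⟩

/-- The rational function `F(X_0 / X_j, ..., X_n / X_j)` on the curve. When `F` is a form of
degree `d`, this is `F / X_j ^ d`. -/
noncomputable def dehom (C : ProjCurve K n) (j : Fin (n + 1))
    (F : MvPolynomial (Fin (n + 1)) K) : C.functionField :=
  aeval (fun i => C.ratio i j) F

/-- The forms `F_0, ..., F_m`, all of the same degree, define a birational map from `C` to `Y`:
there is an isomorphism of the function fields over `K` that takes the quotients `Y_i / Y_j` of
the coordinate functions of `Y` to the rational functions `F_i / F_j` of `C`. -/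
def IsBirationalVia (C : ProjCurve K n) (Y : ProjCurve K m)
    (F : Fin (m + 1) → MvPolynomial (Fin (n + 1)) K) : Prop :=
  (∃ d, ∀ i, (F i).IsHomogeneous d) ∧
  ∃ l, X l ∉ C.ideal ∧ ∃ e : Y.functionField ≃ₐ[K] C.functionField,
    ∀ i j, e (Y.ratio i j) = C.dehom l (F i) / C.dehom l (F j)

/-- A curve in `PG(n, K)` is nonsingular when at each of its points the gradients of the
polynomials of its ideal span a space of dimension `n - 1` (Jacobian criterion). -/
def IsNonsingular (C : ProjCurve K n) : Prop :=
  ∀ (v : Fin (n + 1) → K) (hv : v ≠ 0), Projectivization.mk K v hv ∈ C.carrier →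
    Module.finrank K (Submodule.span K
      {w : Fin (n + 1) → K | ∃ f ∈ C.ideal, w = fun i => eval v (pderiv i f)}) + 1 = n

/-- The Hilbert function of a curve: the dimension of the homogeneous component of degree `s` of
its homogeneous coordinate ring. -/
noncomputable def hilbertFunction (C : ProjCurve K n) (s : ℕ) : ℕ :=
  Module.finrank K ((homogeneousSubmodule (Fin (n + 1)) K s).map
    (Ideal.Quotient.mkₐ K C.ideal).toLinearMap)

/-- A curve has degree `d` when its Hilbert polynomial is `d * s + a` for some integer `a`. -/
def HasDegree (C : ProjCurve K n) (d : ℕ) : Prop :=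
  ∃ a : ℤ, ∀ᶠ s : ℕ in Filter.atTop, (C.hilbertFunction s : ℤ) = d * s + a

/-- The ring homomorphism `E : K(C) → K(C)⟦T⟧`, `a ↦ ∑ D^(i)(a) T ^ i`, which collects the Hasse
derivatives with respect to a separating variable `ζ` of `K(C)`. It is the unique homomorphism
over `K` with `D^(0)(a) = a` and `E(ζ) = ζ + T`. -/
structure IsHasseExpansion (C : ProjCurve K n) (ζ : C.functionField)
    (E : C.functionField →ₐ[K] PowerSeries C.functionField) : Prop where
  separating : Algebra.IsSeparable K⟮ζ⟯ C.functionField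
  hasse_zero : ∀ a, PowerSeries.constantCoeff (E a) = a
  hasse_var : E ζ = PowerSeries.C ζ + PowerSeries.X

/-- The lexicographically smallest strictly increasing sequence with a given property. -/
def IsLexLeast {s : ℕ} (p : (Fin s → ℕ) → Prop) (ε : Fin s → ℕ) : Prop :=
  StrictMono ε ∧ p ε ∧ ∀ ε' : Fin s → ℕ, StrictMono ε' → p ε' → toLex ε ≤ toLex ε'

/-- `ε` is the order sequence of the linear series cut out on `C` by the forms
`∑ a_i F_i` (all `F_i` of the same degree): with `f_i` the rational function `F_i / X_l ^ d`, it is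
the lexicographically smallest sequence `ε_0 < ... < ε_r` with `det (D^(ε_i) f_j) ≠ 0`. It does not
depend on the choice of `X_l` and of the separating variable. -/
def IsOrderSequence (C : ProjCurve K n) (F : Fin (r + 1) → MvPolynomial (Fin (n + 1)) K)
    (ε : Fin (r + 1) → ℕ) : Prop :=
  (∃ d, ∀ i, (F i).IsHomogeneous d) ∧
  ∃ l, X l ∉ C.ideal ∧ ∃ ζ E, C.IsHasseExpansion ζ E ∧
    IsLexLeast (fun ε' : Fin (r + 1) → ℕ =>
      (Matrix.of fun i j => PowerSeries.coeff (ε' i) (E (C.dehom l (F j)))).det ≠ 0) ε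

/-- The linear series cut out on `C` by the `F_i` is non-classical: its order sequence is not
`0, 1, ..., r`. -/
def IsNonclassical (C : ProjCurve K n) (F : Fin (r + 1) → MvPolynomial (Fin (n + 1)) K) : Prop :=
  ∃ ε, C.IsOrderSequence F ε ∧ ε ≠ Fin.val

/-- A polynomial all of whose coefficients lie in the subfield with `Q` elements. -/
def PolyDefinedOver (Q : ℕ) (f : MvPolynomial (Fin (n + 1)) K) : Prop :=
  ∀ s, coeff s f ^ Q = coeff s f

/-- The curve is defined by homogeneous equations over the subfield with `Q` elements. -/
def IsDefinedOver (C : ProjCurve K n) (Q : ℕ) : Prop :=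
  ∃ S : Set (MvPolynomial (Fin (n + 1)) K),
    (∀ f ∈ S, (∃ d, f.IsHomogeneous d) ∧ PolyDefinedOver Q f) ∧ C.carrier = projZeroLocus S

/-- `ν` is the Frobenius order sequence over the field with `Q` elements of the linear series cut
out on `C` by the `F_i`, where `C` and the `F_i` are defined over that field: the
lexicographically smallest sequence `ν_0 < ... < ν_(r-1)` such that the determinant with rows
`(f_0 ^ Q, ..., f_r ^ Q)` and `(D^(ν_i) f_0, ..., D^(ν_i) f_r)` is not zero. -/
def IsFrobeniusOrderSequence (C : ProjCurve K n) (Q : ℕ)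
    (F : Fin (r + 1) → MvPolynomial (Fin (n + 1)) K) (ν : Fin r → ℕ) : Prop :=
  C.IsDefinedOver Q ∧ (∀ i, PolyDefinedOver Q (F i)) ∧ (∃ d, ∀ i, (F i).IsHomogeneous d) ∧
  ∃ l, X l ∉ C.ideal ∧ ∃ ζ E, C.IsHasseExpansion ζ E ∧
    IsLexLeast (fun ν' : Fin r → ℕ =>
      (Matrix.of (Fin.cons (fun j => C.dehom l (F j) ^ Q)
        (fun i j => PowerSeries.coeff (ν' i) (E (C.dehom l (F j)))) :
          Fin (r + 1) → Fin (r + 1) → C.functionField)).det ≠ 0) ν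

/-- The linear series cut out on `C` by the `F_i` is Frobenius non-classical over the field with
`Q` elements: its Frobenius order sequence is not `0, 1, ..., r - 1`. -/
def IsFrobeniusNonclassical (C : ProjCurve K n) (Q : ℕ)
    (F : Fin (r + 1) → MvPolynomial (Fin (n + 1)) K) : Prop :=
  ∃ ν, C.IsFrobeniusOrderSequence Q F ν ∧ ν ≠ Fin.val

/-- The linear series of hyperplane sections of a curve in `PG(n, K)` is cut out by the coordinate
forms. The order sequence of a projective curve is that of its hyperplane sections. -/
noncomputable def planes (K : Type*) [Field K] (n : ℕ) :
    Fin (n + 1) → MvPolynomial (Fin (n + 1)) K :=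
  fun i => X i

end ProjCurve

/-- The form `(X₁^q + X₁X₃^(q-1))(X₂^q + X₂X₃^(q-1)) - c X₃^(2q)`, which defines the plane model of
the Artin-Schreier-Mumford curve. The indices are shifted by one. -/
noncomputable def asmForm {K : Type*} [Field K] (q : ℕ) (c : K) : MvPolynomial (Fin 3) K :=
  (X 0 ^ q + X 0 * X 2 ^ (q - 1)) * (X 1 ^ q + X 1 * X 2 ^ (q - 1)) - C c * X 2 ^ (2 * q)

/-- The forms `X₁X₃, X₂X₃, X₁X₂, X₃²`; they span the conics through the points `(1:0:0)` and
`(0:1:0)`. The indices are shifted by one. -/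
noncomputable def asmTau (K : Type*) [Field K] : Fin 4 → MvPolynomial (Fin 3) K :=
  ![X 0 * X 2, X 1 * X 2, X 0 * X 1, X 2 ^ 2]

/-! Algebra. The affine curve `(x^q + x)(y^q + y) = c` is irreducible: as a polynomial in `y`, its
reversal is Eisenstein at the prime `x` of `K[x]`. Let `R` be its coordinate ring. In `R[t]` the
points `(xt, yt, t)` and `(xt, yt, xyt, t)` are generic points of the cones over the plane and the
space model. A rewriting argument reduces every monomial, modulo the obvious equations, to monomials
whose values at the generic point are linearly independent over `K`. So the obvious equations
generate the ideals (`ker_planePoint`, `ker_spacePoint`): the space model is the complete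
intersection of the quadric `X₀X₁ = X₂X₃` with a surface of degree `q`. Its degree `2q` comes from
counting reduced monomials, its smoothness from the Jacobian of the two equations.

Orders. On both models the linear series is spanned by `x, y, xy, 1`, so everything happens in the
common function field (`IsASMField`). Put `u = x^q + x`, `v = y^q + y`, and let `y_n` be the `n`-th
Hasse derivative of `y` with respect to `x`. Expanding `uv = c` at `x + T` gives `u y_1 = -v`, `u
y_n = -y_{n-1}` for `2 ≤ n < q`, and `u (y_q + y_1^q) = -(y_{q-1} + v)`, because a `q`-th power has
no terms in `T, ..., T^(q-1)`. The determinant with orders `0, 1, 2, j` is `y_j y_1 - y_2 y_{j-1}`.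
It vanishes for `2 < j < q`, since both `y_j / y_{j-1}` and `y_2 / y_1` equal `-1/u`. For `j = q` it
is `y_1 (y_1 - y_1^q)`, which is not zero because `y_1 = -c/u^2` is transcendental over `K`.

Frobenius orders. Put `A = x^(q^2) - x` and `B = y^(q^2) - y`. If `c^q = c`, raising `uv = c` to the
power `q` gives `(u + A)(v + B) = uv`. It follows that `u` times the Frobenius determinant with
orders `0, 1, i` equals `AB (y_{i-1} + u y_i)`. This is zero for `2 ≤ i < q` and equals `AB u (y_1 -
y_1^q) ≠ 0` for `i = q`. -/

namespace ASM

/-- The polynomial `(x^q + x)(y^q + y) - c` in `K[x][y]`. -/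
noncomputable def affinePoly {K : Type*} [Field K] (q : ℕ) (c : K) : Polynomial (Polynomial K) :=
  Polynomial.C (Polynomial.X ^ q + Polynomial.X) * (Polynomial.X ^ q + Polynomial.X) -
    Polynomial.C (Polynomial.C c)

/-! ### Irreducibility of the affine curve and a monomial family in its coordinate ring. -/

section AffinePoly

variable {K : Type*} [Field K] {q : ℕ} {c : K}

theorem natDegree_pow_add_X {R : Type*} [CommRing R] [Nontrivial R] (hq : 2 ≤ q) :
    (Polynomial.X ^ q + Polynomial.X : Polynomial R).natDegree = q := by
  compute_degree!
  · rw [if_neg (by omega)]; simp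
  · omega

theorem coeff_affinePoly (n : ℕ) : (affinePoly q c).coeff n =
    (Polynomial.X ^ q + Polynomial.X) * ((if n = q then 1 else 0) + if 1 = n then 1 else 0) -
      if n = 0 then Polynomial.C c else 0 := by
  rw [affinePoly, Polynomial.coeff_sub, Polynomial.coeff_C_mul, Polynomial.coeff_add,
    Polynomial.coeff_X_pow, Polynomial.coeff_X, Polynomial.coeff_C]

theorem pow_add_X_ne_zero {R : Type*} [CommRing R] [Nontrivial R] (hq : 2 ≤ q) :
    (Polynomial.X ^ q + Polynomial.X : Polynomial R) ≠ 0 := by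
  intro h
  have := natDegree_pow_add_X (R := R) hq
  rw [h] at this
  simp at this
  omega

theorem natDegree_affinePoly (hq : 2 ≤ q) : (affinePoly q c).natDegree = q := by
  apply Polynomial.natDegree_eq_of_le_of_coeff_ne_zero
  · rw [Polynomial.natDegree_le_iff_coeff_eq_zero]
    intro N hN
    rw [coeff_affinePoly, if_neg (by omega), if_neg (by omega), if_neg (by omega)]
    simp
  · rw [coeff_affinePoly, if_pos rfl, if_neg (by omega), if_neg (by omega)]
    simpa using pow_add_X_ne_zero hq

theorem leadingCoeff_affinePoly (hq : 2 ≤ q) :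
    (affinePoly q c).leadingCoeff = Polynomial.X ^ q + Polynomial.X := by
  rw [Polynomial.leadingCoeff, natDegree_affinePoly hq, coeff_affinePoly, if_pos rfl,
    if_neg (by omega), if_neg (by omega)]
  simp

/-- Reversal is multiplicative over a domain, and it preserves the degree of every factor of `f`,
since the constant coefficients are nonzero. So a factor whose reversal is a unit is itself a
constant unit. -/
theorem irreducible_of_irreducible_reverse {R : Type*} [CommRing R] [IsDomain R]
    {f : Polynomial R} (h0 : f.coeff 0 ≠ 0) (hf : Irreducible f.reverse) : Irreducible f := by
  have key : ∀ a b : Polynomial R, a * b = f → IsUnit a.reverse → IsUnit a := by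
    intro a b hab ha
    have ha0 : a.coeff 0 ≠ 0 := by
      rintro h
      apply h0
      rw [← hab, Polynomial.mul_coeff_zero, h, zero_mul]
    have hd := Polynomial.natDegree_eq_zero_of_isUnit ha
    have hd' : a.natDegree = 0 := by
      have := Polynomial.natDegree_eq_reverse_natDegree_add_natTrailingDegree a
      rw [hd, Polynomial.natTrailingDegree_eq_zero.2 (Or.inr ha0)] at this
      exact this
    rw [Polynomial.eq_C_of_natDegree_eq_zero hd'] at ha ⊢
    simpa using ha
  refine ⟨?_, ?_⟩
  · intro hu
    apply hf.not_isUnit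
    have hd := Polynomial.natDegree_eq_zero_of_isUnit hu
    rw [Polynomial.eq_C_of_natDegree_eq_zero hd] at hu ⊢
    simpa using hu
  · intro a b hab
    have := hf.isUnit_or_isUnit (a := a.reverse) (b := b.reverse)
      (by rw [hab, Polynomial.reverse_mul_of_domain])
    rcases this with h | h
    · exact Or.inl (key a b hab.symm h)
    · exact Or.inr (key b a (by rw [mul_comm, hab]) h)

theorem coeff_reverse_affinePoly (hq : 2 ≤ q) (n : ℕ) : (affinePoly q c).reverse.coeff n =
    (Polynomial.X ^ q + Polynomial.X) * ((if n = 0 then 1 else 0) + if n = q - 1 then 1 else 0) -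
      if n = q then Polynomial.C c else 0 := by
  rw [Polynomial.coeff_reverse, natDegree_affinePoly hq, coeff_affinePoly]
  by_cases h : n ≤ q
  · rw [Polynomial.revAt_le h]
    congr 1
    · congr 1; congr 1
      · exact if_congr (by omega) rfl rfl
      · exact if_congr (by omega) rfl rfl
    · exact if_congr (by omega) rfl rfl
  · rw [Polynomial.revAt_eq_self_of_lt (by omega)]
    simp only [show n ≠ q by omega, show n ≠ 0 by omega, show 1 ≠ n by omega,
      show n ≠ q - 1 by omega, if_false]

/-- Eisenstein fails for the polynomial itself, whose leading coefficient is divisible by `x`.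
Reversal moves the unit `-c` to the top. -/
theorem irreducible_affinePoly (hq : 2 ≤ q) (hc : c ≠ 0) : Irreducible (affinePoly q c) := by
  have hc0 : (affinePoly q c).coeff 0 ≠ 0 := by
    rw [coeff_affinePoly, if_neg (by omega), if_neg (by omega), if_pos rfl]
    simpa using hc
  apply irreducible_of_irreducible_reverse hc0
  have hnd : (affinePoly q c).reverse.natDegree = q := by
    have := Polynomial.natDegree_eq_reverse_natDegree_add_natTrailingDegree (affinePoly q c)
    rw [Polynomial.natTrailingDegree_eq_zero.2 (Or.inr hc0), natDegree_affinePoly hq] at this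
    exact this.symm
  have hlc : (affinePoly q c).reverse.leadingCoeff = - Polynomial.C c := by
    rw [Polynomial.leadingCoeff, hnd, coeff_reverse_affinePoly hq, if_neg (by omega),
      if_neg (by omega), if_pos rfl]
    simp
  have hcu : IsUnit (Polynomial.C c) := Polynomial.isUnit_C.2 (isUnit_iff_ne_zero.2 hc)
  have hP : (Ideal.span {(Polynomial.X : Polynomial K)}).IsPrime :=
    (Ideal.span_singleton_prime Polynomial.X_ne_zero).2 Polynomial.prime_X
  refine Polynomial.irreducible_of_eisenstein_criterion hP ?_ ?_ ?_ ?_ ?_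
  · rw [hlc]
    intro h
    exact hP.ne_top (Ideal.eq_top_of_isUnit_mem _ h hcu.neg)
  · intro n hn
    rw [Polynomial.degree_eq_natDegree (by rintro h; simp [h] at hnd; omega), hnd] at hn
    have hn' : n ≠ q := by
      rintro rfl; exact lt_irrefl _ hn
    rw [coeff_reverse_affinePoly hq, if_neg hn', sub_zero]
    apply Ideal.mul_mem_right
    rw [Ideal.mem_span_singleton]
    exact dvd_add (dvd_pow_self _ (by omega)) dvd_rfl
  · rw [← Polynomial.natDegree_pos_iff_degree_pos, hnd]; omega
  · rw [coeff_reverse_affinePoly hq, if_pos rfl, if_neg (by omega), if_neg (by omega),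
      Ideal.span_singleton_pow, Ideal.mem_span_singleton]
    intro h
    -- The constant coefficient `x^q + x` has a simple zero at `x = 0`.
    have h2 : (Polynomial.X : Polynomial K) ^ 2 ∣ Polynomial.X := by
      have h3 : (Polynomial.X : Polynomial K) ^ 2 ∣ Polynomial.X ^ q := pow_dvd_pow _ hq
      simp only [add_zero, mul_one, sub_zero] at h
      exact (dvd_add_right h3).1 h
    have := Polynomial.natDegree_le_of_dvd h2 Polynomial.X_ne_zero
    simp at this
  · rw [Polynomial.isPrimitive_iff_isUnit_of_C_dvd]
    intro r hr
    rw [Polynomial.C_dvd_iff_dvd_coeff] at hr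
    have := hr (affinePoly q c).reverse.natDegree
    rw [Polynomial.coeff_natDegree, hlc] at this
    exact isUnit_of_dvd_unit this hcu.neg

theorem prime_affinePoly (hq : 2 ≤ q) (hc : c ≠ 0) : Prime (affinePoly q c) :=
  (irreducible_affinePoly hq hc).prime

/-- The coordinate ring of the affine curve `(x^q + x)(y^q + y) = c`. -/
abbrev AffineRing {K : Type*} [Field K] (q : ℕ) (c : K) : Type _ := AdjoinRoot (affinePoly q c)

theorem isDomain_affineRing (hq : 2 ≤ q) (hc : c ≠ 0) : IsDomain (AffineRing q c) :=
  AdjoinRoot.isDomain_of_prime (prime_affinePoly hq hc)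

variable (q c) in
/-- The function `x` on the affine curve. -/
noncomputable def affX : AffineRing q c := AdjoinRoot.of _ Polynomial.X

variable (q c) in
/-- The function `y` on the affine curve. -/
noncomputable def affY : AffineRing q c := AdjoinRoot.root _

theorem affine_relation :
    (affX q c ^ q + affX q c) * (affY q c ^ q + affY q c) = algebraMap K _ c := by
  have : AdjoinRoot.mk (affinePoly q c) (affinePoly q c) = 0 := AdjoinRoot.mk_self
  rw [affinePoly] at this
  simp only [map_sub, map_mul, map_add, map_pow, AdjoinRoot.mk_C, AdjoinRoot.mk_X, sub_eq_zero]
    at this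
  exact this

/-- The exponents `(i, j)` of the monomials `x^i y^j` that are not divisible by `x^q y^q`. -/
abbrev ReducedExp (q : ℕ) : Type := {ij : ℕ × ℕ // ¬ (q ≤ ij.1 ∧ q ≤ ij.2)}

theorem linearIndependent_bivariate :
    LinearIndependent K (fun ij : ℕ × ℕ =>
      (Polynomial.C (Polynomial.X ^ ij.1) * Polynomial.X ^ ij.2 : Polynomial (Polynomial K))) := by
  have h1 : LinearIndependent K (fun i : ℕ => (Polynomial.X ^ i : Polynomial K)) := by
    have := (Polynomial.basisMonomials K).linearIndependent
    convert this using 1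
    ext1 i
    simp [Polynomial.X_pow_eq_monomial]
  have h2 : LinearIndependent (Polynomial K)
      (fun i : ℕ => (Polynomial.X ^ i : Polynomial (Polynomial K))) := by
    have := (Polynomial.basisMonomials (Polynomial K)).linearIndependent
    convert this using 1
    ext1 i
    simp [Polynomial.X_pow_eq_monomial]
  have := linearIndependent_smul h1 h2
  convert this using 1
  ext1 ij
  rw [Polynomial.smul_eq_C_mul]

/-- A nonzero multiple of the defining polynomial has `y`-degree at least `q`, and its leading
coefficient in `y` has `x`-degree at least `q`. A combination of monomials not divisible by `x^q
y^q` cannot look like this. -/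
theorem linearIndependent_affine (hq : 2 ≤ q) :
    LinearIndependent K (fun ij : ReducedExp q => affX q c ^ ij.1.1 * affY q c ^ ij.1.2) := by
  have h := (linearIndependent_bivariate (K := K)).comp (Subtype.val : ReducedExp q → ℕ × ℕ)
    Subtype.val_injective
  let f : Polynomial (Polynomial K) →ₗ[K] AffineRing q c :=
    (Ideal.Quotient.mkₐ K (Ideal.span {affinePoly q c})).toLinearMap
  have hf (P : Polynomial (Polynomial K)) : f P = AdjoinRoot.mk (affinePoly q c) P := rfl
  have := h.map (f := f) ?_
  · have e : (fun ij : ReducedExp q => affX q c ^ ij.1.1 * affY q c ^ ij.1.2) =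
        f ∘ (fun ij : ℕ × ℕ => (Polynomial.C (Polynomial.X ^ ij.1) * Polynomial.X ^ ij.2 :
          Polynomial (Polynomial K))) ∘ (Subtype.val : ReducedExp q → ℕ × ℕ) := by
      ext1 ij
      simp [affX, affY, hf]
    rw [e]
    exact this
  · rw [Submodule.disjoint_def]
    intro P hP hP0
    -- `N` collects the polynomials with no monomial divisible by `x^q y^q`.
    let N : Submodule K (Polynomial (Polynomial K)) :=
      { carrier := {P | ∀ n, q ≤ n → (P.coeff n).degree < q}
        add_mem' := by
          intro a b ha hb n hn
          rw [Polynomial.coeff_add]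
          exact (Polynomial.degree_add_le _ _).trans_lt (max_lt (ha n hn) (hb n hn))
        zero_mem' := by
          intro n hn
          simp
        smul_mem' := by
          intro r a ha n hn
          rw [Polynomial.coeff_smul]
          exact (Polynomial.degree_smul_le _ _).trans_lt (ha n hn) }
    have hN : P ∈ N := by
      refine (Submodule.span_le.2 ?_) hP
      rintro _ ⟨⟨⟨i, j⟩, hij⟩, rfl⟩ n hn
      simp only [Function.comp, Polynomial.coeff_C_mul, Polynomial.coeff_X_pow]
      split_ifs with h
      · simp only [mul_one, Polynomial.degree_X_pow]
        simp only at hij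
        have : i < q := by omega
        exact_mod_cast this
      · simp
    by_contra hne
    have hdvd : affinePoly q c ∣ P := by
      rw [LinearMap.mem_ker] at hP0
      exact AdjoinRoot.mk_eq_zero.1 hP0
    obtain ⟨g, rfl⟩ := hdvd
    have hg : g ≠ 0 := right_ne_zero_of_mul hne
    have hf : affinePoly q c ≠ 0 := left_ne_zero_of_mul hne
    have h1 := hN (affinePoly q c * g).natDegree
      (by rw [Polynomial.natDegree_mul hf hg, natDegree_affinePoly hq]; omega)
    rw [Polynomial.coeff_natDegree, Polynomial.leadingCoeff_mul, leadingCoeff_affinePoly hq,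
      Polynomial.degree_mul, Polynomial.degree_eq_natDegree (pow_add_X_ne_zero hq),
      natDegree_pow_add_X hq, Polynomial.degree_eq_natDegree (by simpa using hg)] at h1
    norm_cast at h1
    omega

/-- The monomials `x^i y^j t^s`, with `x^q y^q` not dividing `x^i y^j`, are linearly independent in
the polynomial ring over the affine coordinate ring. -/
theorem linearIndependent_cone (hq : 2 ≤ q) :
    LinearIndependent K (fun ijs : ReducedExp q × ℕ =>
      (Polynomial.C (affX q c ^ ijs.1.1.1 * affY q c ^ ijs.1.1.2) * Polynomial.X ^ ijs.2 :
        Polynomial (AffineRing q c))) := by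
  have h2 : LinearIndependent (AffineRing q c)
      (fun i : ℕ => (Polynomial.X ^ i : Polynomial (AffineRing q c))) := by
    have := (Polynomial.basisMonomials (AffineRing q c)).linearIndependent
    convert this using 1
    ext1 i
    simp [Polynomial.X_pow_eq_monomial]
  have := linearIndependent_smul (linearIndependent_affine (c := c) hq) h2
  convert this using 1
  ext1 ij
  rw [Polynomial.smul_eq_C_mul]

end AffinePoly

/-! ### Reduction of monomials modulo a homogeneous ideal. -/

section Reduction

variable {K : Type*} [Field K] {n : ℕ}

/-- The monomial with a given function of exponents. -/
noncomputable def mon (K : Type*) [Field K] {n : ℕ} (e : Fin n → ℕ) : MvPolynomial (Fin n) K :=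
  ∏ i, X i ^ e i

theorem mon_add (e e' : Fin n → ℕ) : mon K (e + e') = mon K e * mon K e' := by
  simp [mon, pow_add, Finset.prod_mul_distrib]

theorem mon_eq_monomial (e : Fin n →₀ ℕ) : mon K e = monomial e 1 := by
  rw [monomial_eq, mon, Finsupp.prod_fintype _ _ (by simp)]
  simp

theorem isHomogeneous_mon (e : Fin n → ℕ) : (mon K e).IsHomogeneous (∑ i, e i) :=
  IsHomogeneous.prod _ _ _ fun i _ => by simpa using (isHomogeneous_X K i).pow (e i)

theorem mem_span_mon_of_isHomogeneous {f : MvPolynomial (Fin n) K} {d : ℕ}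
    (hf : f.IsHomogeneous d) :
    f ∈ Submodule.span K (mon K '' {t : Fin n → ℕ | ∑ i, t i = d}) := by
  rw [f.as_sum]
  refine Submodule.sum_mem _ fun v hv => ?_
  rw [← mul_one (coeff v f), ← smul_eq_mul, ← smul_monomial, ← mon_eq_monomial]
  refine Submodule.smul_mem _ _ (Submodule.subset_span ⟨v, ?_, rfl⟩)
  have := hf (mem_support_iff.1 hv)
  rw [Set.mem_ofPred_eq, ← this, Finsupp.weight_apply, Finsupp.sum_fintype _ _ (by simp)]
  simp

theorem mem_span_mon (f : MvPolynomial (Fin n) K) :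
    f ∈ Submodule.span K (Set.range (mon K (n := n))) := by
  rw [f.as_sum]
  refine Submodule.sum_mem _ fun v hv => ?_
  rw [← mul_one (coeff v f), ← smul_eq_mul, ← smul_monomial, ← mon_eq_monomial]
  exact Submodule.smul_mem _ _ (Submodule.subset_span ⟨v, rfl⟩)

/-- If every monomial outside `N` is divisible by the leading monomial of a homogeneous rewriting
rule of `J` that lowers the weight, every monomial reduces modulo `J` to monomials in `N` of the
same degree. -/
theorem mon_mem_sup_of_rewriting {w : Fin n → ℕ} {J : Ideal (MvPolynomial (Fin n) K)}
    {N : Set (Fin n → ℕ)}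
    (h : ∀ e ∉ N, ∃ e₀ ≤ e, ∃ g ∈ Submodule.span K
      (mon K '' {t | ∑ i, w i * t i < ∑ i, w i * e₀ i ∧ ∑ i, t i = ∑ i, e₀ i}), mon K e₀ - g ∈ J)
    (e : Fin n → ℕ) :
    mon K e ∈ J.restrictScalars K ⊔ Submodule.span K (mon K '' {t | t ∈ N ∧ ∑ i, t i = ∑ i, e i})
    := by
  induction hW : ∑ i, w i * e i using Nat.strong_induction_on generalizing e with
  | _ W ih =>
    subst hW
    by_cases he : e ∈ N
    · exact Submodule.mem_sup_right (Submodule.subset_span ⟨e, ⟨he, rfl⟩, rfl⟩)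
    · obtain ⟨e₀, hle, g, hg, hJ⟩ := h e he
      obtain ⟨r, rfl⟩ : ∃ r, e = r + e₀ := ⟨e - e₀, by
        ext i; have : e₀ i ≤ e i := hle i; simp only [Pi.add_apply, Pi.sub_apply]; omega⟩
      have e1 : mon K (r + e₀) = mon K r * (mon K e₀ - g) + mon K r * g := by
        rw [mon_add]; ring
      rw [e1]
      refine Submodule.add_mem _ (Submodule.mem_sup_left (J.mul_mem_left _ hJ)) ?_
      refine Submodule.span_induction (p := fun g _ => mon K r * g ∈ _) ?_ ?_ ?_ ?_ hg
      · rintro _ ⟨t, ⟨ht1, ht2⟩, rfl⟩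
        have h3 : ∑ i, (r + t) i = ∑ i, (r + e₀) i := by
          simp only [Pi.add_apply, Finset.sum_add_distrib, ht2]
        rw [← mon_add, ← h3]
        refine ih _ ?_ (r + t) rfl
        simp only [Pi.add_apply, mul_add, Finset.sum_add_distrib]
        omega
      · rw [mul_zero]; exact Submodule.zero_mem _
      · intro a b _ _ ha hb
        rw [mul_add]; exact Submodule.add_mem _ ha hb
      · intro a b _ hb
        rw [mul_smul_comm]; exact Submodule.smul_mem _ _ hb

/-- Modulo `J`, an element of the kernel is a combination of reduced monomials; their images are
independent, so the combination is zero. -/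
theorem ker_eq_of_linearIndependent {ι A : Type*} [CommRing A] [Algebra K A]
    {J : Ideal (MvPolynomial (Fin n) K)} {φ : MvPolynomial (Fin n) K →ₐ[K] A}
    (hJ : J ≤ RingHom.ker φ) {m : ι → Fin n → ℕ}
    (hspan : ∀ e, mon K e ∈ J.restrictScalars K ⊔ Submodule.span K (mon K '' Set.range m))
    (hli : LinearIndependent K fun i => φ (mon K (m i))) : RingHom.ker φ = J := by
  refine le_antisymm (fun f hf => ?_) hJ
  have h1 : f ∈ J.restrictScalars K ⊔ Submodule.span K (mon K '' Set.range m) := by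
    refine Submodule.span_le.2 ?_ (mem_span_mon f)
    rintro _ ⟨e, rfl⟩
    exact hspan e
  obtain ⟨a, ha, b, hb, rfl⟩ := Submodule.mem_sup.1 h1
  have hb0 : φ b = 0 := by
    have h2 : φ (a + b) = 0 := hf
    rwa [map_add, show φ a = 0 from hJ ha, zero_add] at h2
  rw [← Set.range_comp, Finsupp.mem_span_range_iff_exists_finsupp] at hb
  obtain ⟨l, rfl⟩ := hb
  have hl : l = 0 := by
    rw [linearIndependent_iff] at hli
    apply hli
    rw [← hb0, Finsupp.linearCombination_apply, Finsupp.sum, Finsupp.sum, map_sum]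
    simp
  subst hl
  simpa using ha

end Reduction

/-! ### Equations of the two models. -/

section Models

variable {K : Type*} [Field K] {q : ℕ} {c : K}

/-- The form of degree two that, with `surfaceForm`, defines the space model. -/
noncomputable def quadricForm (K : Type*) [Field K] : MvPolynomial (Fin 4) K :=
  X 0 * X 1 - X 2 * X 3

/-- The form of degree `q` that, with `quadricForm`, defines the space model. -/
noncomputable def surfaceForm (q : ℕ) (c : K) : MvPolynomial (Fin 4) K :=
  X 2 ^ q + (X 0 ^ (q - 1) + X 1 ^ (q - 1) + X 3 ^ (q - 1)) * X 2 - C c * X 3 ^ q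

variable (q c) in
/-- The generic point of the affine cone over the plane model. -/
noncomputable def planePoint : MvPolynomial (Fin 3) K →ₐ[K] Polynomial (AffineRing q c) :=
  aeval ![Polynomial.C (affX q c) * Polynomial.X, Polynomial.C (affY q c) * Polynomial.X,
    Polynomial.X]

variable (q c) in
/-- The generic point of the affine cone over the space model. -/
noncomputable def spacePoint : MvPolynomial (Fin 4) K →ₐ[K] Polynomial (AffineRing q c) :=
  aeval ![Polynomial.C (affX q c) * Polynomial.X, Polynomial.C (affY q c) * Polynomial.X,
    Polynomial.C (affX q c * affY q c) * Polynomial.X, Polynomial.X]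

/-- The reduced monomials for the plane model. -/
def planeExp (a : ReducedExp q × ℕ) : Fin 3 → ℕ := ![a.1.1.1, a.1.1.2, a.2]

/-- The reduced monomials for the space model. -/
def spaceExp (a : ReducedExp q × ℕ) : Fin 4 → ℕ :=
  ![a.1.1.1 - min a.1.1.1 a.1.1.2, a.1.1.2 - min a.1.1.1 a.1.1.2, min a.1.1.1 a.1.1.2, a.2]

theorem planePoint_mon (a : ReducedExp q × ℕ) : planePoint q c (mon K (planeExp a)) =
    Polynomial.C (affX q c ^ a.1.1.1 * affY q c ^ a.1.1.2) *
      Polynomial.X ^ (a.1.1.1 + a.1.1.2 + a.2) := by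
  simp [planePoint, mon, planeExp, Fin.prod_univ_three]
  ring

/-- The product `xy` is used as often as possible: `x^i y^j` takes `min i j` factors `xyt`, and the
remaining factors are all `xt` or all `yt`. The exponent of `t` is therefore `max i j` plus that of
the last coordinate. -/
theorem spacePoint_mon (a : ReducedExp q × ℕ) : spacePoint q c (mon K (spaceExp a)) =
    Polynomial.C (affX q c ^ a.1.1.1 * affY q c ^ a.1.1.2) *
      Polynomial.X ^ (max a.1.1.1 a.1.1.2 + a.2) := by
  obtain ⟨⟨⟨i, j⟩, h⟩, e⟩ := a
  simp only [spacePoint, mon, spaceExp, Fin.prod_univ_four]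
  rcases le_total i j with hij | hij
  · obtain ⟨d, rfl⟩ := Nat.exists_eq_add_of_le hij
    simp
    ring
  · obtain ⟨d, rfl⟩ := Nat.exists_eq_add_of_le hij
    simp
    ring

theorem linearIndependent_planePoint (hq : 2 ≤ q) :
    LinearIndependent K fun a : ReducedExp q × ℕ => planePoint q c (mon K (planeExp a)) := by
  have := (linearIndependent_cone (c := c) hq).comp
    (fun a : ReducedExp q × ℕ => (a.1, a.1.1.1 + a.1.1.2 + a.2)) (by
      rintro ⟨a, s⟩ ⟨b, t⟩ h
      simp only [Prod.mk.injEq] at h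
      obtain ⟨rfl, h⟩ := h
      simpa using h)
  convert this using 1
  ext1 a
  exact planePoint_mon a

theorem linearIndependent_spacePoint (hq : 2 ≤ q) :
    LinearIndependent K fun a : ReducedExp q × ℕ => spacePoint q c (mon K (spaceExp a)) := by
  have := (linearIndependent_cone (c := c) hq).comp
    (fun a : ReducedExp q × ℕ => (a.1, max a.1.1.1 a.1.1.2 + a.2)) (by
      rintro ⟨a, s⟩ ⟨b, t⟩ h
      simp only [Prod.mk.injEq] at h
      obtain ⟨rfl, h⟩ := h
      simpa using h)
  convert this using 1
  ext1 a
  exact spacePoint_mon a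

theorem range_planeExp : Set.range (planeExp (q := q)) = {t | ¬ (q ≤ t 0 ∧ q ≤ t 1)} := by
  ext t
  constructor
  · rintro ⟨⟨⟨⟨i, j⟩, h⟩, e⟩, rfl⟩
    exact h
  · intro h
    refine ⟨⟨⟨⟨t 0, t 1⟩, h⟩, t 2⟩, ?_⟩
    ext i
    fin_cases i <;> rfl

theorem range_spaceExp :
    Set.range (spaceExp (q := q)) = {t | ¬ (1 ≤ t 0 ∧ 1 ≤ t 1) ∧ t 2 < q} := by
  ext t
  constructor
  · rintro ⟨⟨⟨⟨i, j⟩, h⟩, e⟩, rfl⟩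
    simp [spaceExp] at h ⊢
    omega
  · rintro ⟨h, h'⟩
    refine ⟨⟨⟨⟨t 0 + t 2, t 1 + t 2⟩, by simp; omega⟩, t 3⟩, ?_⟩
    ext i
    fin_cases i <;> simp [spaceExp] <;> omega

theorem planePoint_asmForm (hq : 2 ≤ q) : planePoint q c (asmForm q c) = 0 := by
  obtain ⟨r, rfl⟩ := Nat.exists_eq_add_of_le' hq
  have h := congrArg Polynomial.C (affine_relation (q := r + 2) (c := c))
  simp only [map_mul, map_add, map_pow] at h
  have h2 : algebraMap K (Polynomial (AffineRing (r + 2) c)) c =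
    Polynomial.C (algebraMap K _ c) := rfl
  simp [planePoint, asmForm, h2, ← h]
  ring

theorem spacePoint_quadricForm : spacePoint q c (quadricForm K) = 0 := by
  simp [spacePoint, quadricForm]
  ring

theorem spacePoint_surfaceForm (hq : 2 ≤ q) : spacePoint q c (surfaceForm q c) = 0 := by
  obtain ⟨r, rfl⟩ := Nat.exists_eq_add_of_le' hq
  have h := congrArg Polynomial.C (affine_relation (q := r + 2) (c := c))
  simp only [map_mul, map_add, map_pow] at h
  have h2 : algebraMap K (Polynomial (AffineRing (r + 2) c)) c =
    Polynomial.C (algebraMap K _ c) := rfl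
  simp [spacePoint, surfaceForm, h2, ← h]
  ring

theorem plane_reduction (hq : 2 ≤ q) (e : Fin 3 → ℕ) :
    mon K e ∈ (Ideal.span {asmForm q c}).restrictScalars K ⊔
      Submodule.span K (mon K '' {t | t ∈ Set.range (planeExp (q := q)) ∧ ∑ i, t i = ∑ i, e i})
    := by
  -- The weight is the degree in `X₀, X₁`; it makes `X₀^q X₁^q` the leading monomial.
  refine mon_mem_sup_of_rewriting (w := ![1, 1, 0]) (fun e he => ?_) e
  simp only [range_planeExp, Set.mem_ofPred_eq, not_not] at he
  refine ⟨![q, q, 0], ?_, mon K ![q, q, 0] - asmForm q c, ?_, ?_⟩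
  · intro i
    fin_cases i
    · exact he.1
    · exact he.2
    · exact Nat.zero_le _
  · have h1 : mon K ![q, q, 0] - asmForm q c = c • mon K ![0, 0, 2 * q] - mon K ![q, 1, q - 1]
        - mon K ![1, q, q - 1] - mon K ![1, 1, 2 * (q - 1)] := by
      simp [mon, asmForm, Fin.prod_univ_three, smul_eq_C_mul]
      ring
    rw [h1]
    refine Submodule.sub_mem _ (Submodule.sub_mem _ (Submodule.sub_mem _
      (Submodule.smul_mem _ _ ?_) ?_) ?_) ?_ <;>
    · refine Submodule.subset_span ⟨_, ⟨?_, ?_⟩, rfl⟩ <;> simp [Fin.sum_univ_three] <;> omega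
  · rw [sub_sub_cancel]
    exact Ideal.subset_span rfl

theorem space_reduction (hq : 2 ≤ q) (e : Fin 4 → ℕ) :
    mon K e ∈ (Ideal.span {quadricForm K, surfaceForm q c}).restrictScalars K ⊔
      Submodule.span K (mon K '' {t | t ∈ Set.range (spaceExp (q := q)) ∧ ∑ i, t i = ∑ i, e i})
    := by
  -- With these weights `X₀X₁` (weight 4) beats `X₂X₃` (weight 3), and `X₂^q` (weight `3q`) beats
  -- `X₀^(q-1) X₂` and `X₁^(q-1) X₂` (weight `2q + 1`).
  refine mon_mem_sup_of_rewriting (w := ![2, 2, 3, 0]) (fun e he => ?_) e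
  simp only [range_spaceExp, Set.mem_ofPred_eq, not_and_or, not_lt] at he
  rw [← not_and_or, not_not] at he
  rcases he with he | he
  · refine ⟨![1, 1, 0, 0], ?_, mon K ![0, 0, 1, 1], ?_, ?_⟩
    · intro i
      fin_cases i
      · exact he.1
      · exact he.2
      · exact Nat.zero_le _
      · exact Nat.zero_le _
    · refine Submodule.subset_span ⟨_, ⟨?_, ?_⟩, rfl⟩ <;> simp [Fin.sum_univ_four]
    · have : mon K ![1, 1, 0, 0] - mon K ![0, 0, 1, 1] = quadricForm K := by
        simp [mon, quadricForm, Fin.prod_univ_four]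
      rw [this]
      exact Ideal.subset_span (by simp)
  · refine ⟨![0, 0, q, 0], ?_, mon K ![0, 0, q, 0] - surfaceForm q c, ?_, ?_⟩
    · intro i
      fin_cases i
      · exact Nat.zero_le _
      · exact Nat.zero_le _
      · exact he
      · exact Nat.zero_le _
    · have h1 : mon K ![0, 0, q, 0] - surfaceForm q c = c • mon K ![0, 0, 0, q]
          - mon K ![q - 1, 0, 1, 0] - mon K ![0, q - 1, 1, 0] - mon K ![0, 0, 1, q - 1] := by
        simp [mon, surfaceForm, Fin.prod_univ_four, smul_eq_C_mul]
        ring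
      rw [h1]
      refine Submodule.sub_mem _ (Submodule.sub_mem _ (Submodule.sub_mem _
        (Submodule.smul_mem _ _ ?_) ?_) ?_) ?_ <;>
      · refine Submodule.subset_span ⟨_, ⟨?_, ?_⟩, rfl⟩ <;> simp [Fin.sum_univ_four] <;> omega
    · rw [sub_sub_cancel]
      exact Ideal.subset_span (by simp)

theorem ker_planePoint (hq : 2 ≤ q) :
    RingHom.ker (planePoint q c) = Ideal.span {asmForm q c} := by
  refine ker_eq_of_linearIndependent (m := planeExp) ?_ (fun e => ?_)
    (linearIndependent_planePoint hq)
  · rw [Ideal.span_le, Set.singleton_subset_iff]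
    exact planePoint_asmForm hq
  · exact SetLike.le_def.1 (sup_le_sup_left (Submodule.span_mono (Set.image_mono
      (Set.inter_subset_left))) _) (plane_reduction hq e)

theorem ker_spacePoint (hq : 2 ≤ q) :
    RingHom.ker (spacePoint q c) = Ideal.span {quadricForm K, surfaceForm q c} := by
  refine ker_eq_of_linearIndependent (m := spaceExp) ?_ (fun e => ?_)
    (linearIndependent_spacePoint hq)
  · rw [Ideal.span_le, Set.insert_subset_iff, Set.singleton_subset_iff]
    exact ⟨spacePoint_quadricForm, spacePoint_surfaceForm hq⟩
  · exact SetLike.le_def.1 (sup_le_sup_left (Submodule.span_mono (Set.image_mono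
      (Set.inter_subset_left))) _) (space_reduction hq e)

end Models

end ASM

/-! ### Projective closure, Nullstellensatz and images of rational maps. -/

section Projective

variable {K : Type*} [Field K] {n m : ℕ}

theorem subset_projClosure (Y : Set (PG K n)) : Y ⊆ projClosure Y := by
  rintro P hP v hv rfl f hf
  exact hf v hv hP

theorem projIdeal_anti {Y Z : Set (PG K n)} (h : Y ⊆ Z) : projIdeal Z ≤ projIdeal Y :=
  fun _ hf v hv hY => hf v hv (h hY)

theorem projZeroLocus_anti {S T : Set (MvPolynomial (Fin (n + 1)) K)} (h : S ⊆ T) :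
    projZeroLocus T ⊆ projZeroLocus S :=
  fun _ hP v hv hvP f hf => hP v hv hvP f (h hf)

theorem projIdeal_projClosure (Y : Set (PG K n)) : projIdeal (projClosure Y) = projIdeal Y :=
  le_antisymm (projIdeal_anti (subset_projClosure Y)) fun f hf v hv hY => hY v hv rfl f hf

theorem projClosure_projClosure (Y : Set (PG K n)) :
    projClosure (projClosure Y) = projClosure Y := by
  rw [projClosure, projIdeal_projClosure]
  rfl

theorem projClosure_projZeroLocus (S : Set (MvPolynomial (Fin (n + 1)) K)) :
    projClosure (projZeroLocus S) = projZeroLocus S := by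
  refine Set.Subset.antisymm ?_ (subset_projClosure _)
  exact projZeroLocus_anti fun f hf v hv hP => hP v hv rfl f hf

theorem projZeroLocus_span (S : Set (MvPolynomial (Fin (n + 1)) K)) :
    projZeroLocus (Ideal.span S : Set (MvPolynomial (Fin (n + 1)) K)) = projZeroLocus S := by
  refine Set.Subset.antisymm (projZeroLocus_anti Ideal.subset_span) ?_
  intro P hP v hv hvP f hf
  have : Ideal.span S ≤ RingHom.ker (eval v) := Ideal.span_le.2 fun g hg => hP v hv hvP g hg
  exact this hf

theorem eval_smul_of_isHomogeneous {σ : Type*} {f : MvPolynomial σ K} {d : ℕ}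
    (hf : f.IsHomogeneous d) (a : K) (v : σ → K) : eval (a • v) f = a ^ d * eval v f := by
  rw [eval_eq, eval_eq, Finset.mul_sum]
  refine Finset.sum_congr rfl fun s hs => ?_
  have h := hf (mem_support_iff.1 hs)
  rw [Finsupp.weight_apply, Finsupp.sum] at h
  simp only [Pi.one_apply, smul_eq_mul, mul_one] at h
  simp only [Pi.smul_apply, smul_eq_mul, mul_pow, Finset.prod_mul_distrib]
  rw [Finset.prod_pow_eq_pow_sum, h]
  ring

theorem mk_mem_projZeroLocus {S : Set (MvPolynomial (Fin (n + 1)) K)}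
    (hS : ∀ f ∈ S, ∃ d, f.IsHomogeneous d) {v : Fin (n + 1) → K} (hv : v ≠ 0) :
    Projectivization.mk K v hv ∈ projZeroLocus S ↔ ∀ f ∈ S, eval v f = 0 := by
  refine ⟨fun h f hf => h v hv rfl f hf, fun h w hw hvw f hf => ?_⟩
  obtain ⟨a, rfl⟩ := (Projectivization.mk_eq_mk_iff' K w v hw hv).1 hvw
  obtain ⟨d, hd⟩ := hS f hf
  rw [eval_smul_of_isHomogeneous hd, h f hf, mul_zero]

/-- The projective Nullstellensatz for a prime ideal. -/
theorem projIdeal_projZeroLocus [IsAlgClosed K] {S : Set (MvPolynomial (Fin (n + 1)) K)}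
    (hS : ∀ f ∈ S, ∃ d, f.IsHomogeneous d) (hP : (Ideal.span S).IsPrime) {l : Fin (n + 1)}
    (hl : X l ∉ Ideal.span S) : projIdeal (projZeroLocus S) = Ideal.span S := by
  refine le_antisymm (fun f hf => ?_) (Ideal.span_le.2 fun f hf v hv hvS => hvS v hv rfl f hf)
  -- The affine Nullstellensatz also sees the origin, where `f` need not vanish; the factor `X l`
  -- takes care of it and is cancelled by primality.
  have h1 : X l * f ∈ vanishingIdeal K (zeroLocus K (Ideal.span S)) := by
    rw [mem_vanishingIdeal_iff]
    intro v hv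
    rw [zeroLocus_span] at hv
    by_cases hv0 : v = 0
    · subst hv0; simp
    · have := hf v hv0 ((mk_mem_projZeroLocus hS hv0).2 fun g hg => by
        simpa [aeval_eq_eval] using hv g hg)
      rw [aeval_eq_eval]
      simp [this]
  rw [vanishingIdeal_zeroLocus_eq_radical, hP.radical] at h1
  exact (hP.mem_or_mem h1).resolve_left hl

/-- The ideal of the image of a projective set under a rational map. -/
theorem projIdeal_projImage [IsAlgClosed K] {F : Fin (m + 1) → MvPolynomial (Fin (n + 1)) K}
    {d : ℕ} (hd : d ≠ 0) (hF : ∀ i, (F i).IsHomogeneous d) {Y : Set (PG K n)}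
    (hP : (projIdeal Y).IsPrime) {l : Fin (m + 1)} (hl : F l ∉ projIdeal Y) :
    projIdeal (projImage F Y) = (projIdeal Y).comap (aeval F) := by
  have key : ∀ (g : MvPolynomial (Fin (m + 1)) K) (v : Fin (n + 1) → K),
      eval v (aeval F g) = eval (fun i => eval v (F i)) g := by
    intro g v
    have := DFunLike.congr_fun (comp_aeval (R := K) F (aeval v)) g
    simpa [aeval_eq_eval] using this
  ext g
  rw [Ideal.mem_comap]
  constructor
  · intro hg
    -- The factor `F l` vanishes at the base points, where the map is not defined.
    have h1 : F l * aeval F g ∈ projIdeal Y := by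
      intro v hv hvY
      rw [map_mul, key]
      by_cases h0 : (fun i => eval v (F i)) = 0
      · rw [show eval v (F l) = 0 from congrFun h0 l, zero_mul]
      · rw [hg _ h0 ⟨v, hv, h0, hvY, rfl⟩, mul_zero]
    exact (hP.mem_or_mem h1).resolve_left hl
  · rintro hg w hw ⟨v, hv, h0, hvY, hwv⟩
    obtain ⟨a, rfl⟩ := (Projectivization.mk_eq_mk_iff' K w _ hw h0).1 hwv
    -- Scaling the source by `b` scales the image by `b ^ d`, so a `d`-th root reaches every
    -- representative of the image point.
    obtain ⟨b, rfl⟩ := IsAlgClosed.exists_pow_nat_eq a (Nat.pos_of_ne_zero hd)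
    have hb : b ≠ 0 := by
      rintro rfl
      rw [zero_pow hd, zero_smul] at hw
      exact hw rfl
    have hbv : b • v ≠ 0 := smul_ne_zero hb hv
    have h2 := hg (b • v) hbv (by
      rwa [(Projectivization.mk_eq_mk_iff' K (b • v) v hbv hv).2 ⟨b, rfl⟩])
    rw [key] at h2
    have e : (fun i => eval (b • v) (F i)) = b ^ d • fun i => eval v (F i) := by
      ext i
      exact eval_smul_of_isHomogeneous (hF i) b v
    rwa [e] at h2

end Projective

namespace ASM

/-! ### Homogeneous ideals of the two models. -/

section Curves

variable {K : Type*} [Field K] {q : ℕ} {c : K}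

theorem isHomogeneous_asmForm (hq : 2 ≤ q) : (asmForm q c).IsHomogeneous (2 * q) := by
  have h : ∀ i : Fin 3, (X i ^ q + X i * X 2 ^ (q - 1) : MvPolynomial (Fin 3) K).IsHomogeneous q :=
    fun i => by
      refine IsHomogeneous.add (by simpa using (isHomogeneous_X K i).pow q) ?_
      have := (isHomogeneous_X K i).mul ((isHomogeneous_X K (2 : Fin 3)).pow (q - 1))
      convert this using 1
      omega
  refine IsHomogeneous.sub ?_ ?_
  · rw [two_mul]
    exact (h 0).mul (h 1)
  · simpa using (isHomogeneous_C (Fin 3) c).mul ((isHomogeneous_X K (2 : Fin 3)).pow (2 * q))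

theorem isHomogeneous_quadricForm : (quadricForm K).IsHomogeneous 2 :=
  ((isHomogeneous_X K 0).mul (isHomogeneous_X K 1)).sub
    ((isHomogeneous_X K 2).mul (isHomogeneous_X K 3))

theorem isHomogeneous_surfaceForm (hq : 2 ≤ q) : (surfaceForm q c).IsHomogeneous q := by
  have h : ∀ (i : Fin 4) (r : ℕ), (X i ^ r : MvPolynomial (Fin 4) K).IsHomogeneous r :=
    fun i r => by simpa using (isHomogeneous_X K i).pow r
  refine ((h 2 q).add ?_).sub ?_
  · have := (((h 0 (q - 1)).add (h 1 (q - 1))).add (h 3 (q - 1))).mul (isHomogeneous_X K (2 : Fin 4))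
    convert this using 1
    omega
  · simpa using (isHomogeneous_C (Fin 4) c).mul (h 3 q)

theorem isHomogeneous_asmTau (i : Fin 4) : (asmTau K i).IsHomogeneous 2 := by
  have h : ∀ i j : Fin 3, (X i * X j : MvPolynomial (Fin 3) K).IsHomogeneous 2 :=
    fun i j => (isHomogeneous_X K i).mul (isHomogeneous_X K j)
  fin_cases i
  · exact h 0 2
  · exact h 1 2
  · exact h 0 1
  · change (X 2 ^ 2 : MvPolynomial (Fin 3) K).IsHomogeneous 2
    simpa using (isHomogeneous_X K (2 : Fin 3)).pow 2

theorem isPrime_ker_planePoint (hq : 2 ≤ q) (hc : c ≠ 0) :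
    (RingHom.ker (planePoint q c)).IsPrime := by
  have := isDomain_affineRing hq hc
  exact RingHom.ker_isPrime _

theorem isPrime_ker_spacePoint (hq : 2 ≤ q) (hc : c ≠ 0) :
    (RingHom.ker (spacePoint q c)).IsPrime := by
  have := isDomain_affineRing hq hc
  exact RingHom.ker_isPrime _

theorem X_two_notMem_ker_planePoint (hq : 2 ≤ q) (hc : c ≠ 0) :
    X 2 ∉ RingHom.ker (planePoint q c) := by
  have := isDomain_affineRing hq hc
  simp [planePoint, RingHom.mem_ker]

theorem projIdeal_plane [IsAlgClosed K] (hq : 2 ≤ q) (hc : c ≠ 0) :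
    projIdeal (projZeroLocus {asmForm q c}) = RingHom.ker (planePoint q c) := by
  rw [ker_planePoint hq]
  refine projIdeal_projZeroLocus (l := 2) ?_ ?_ ?_
  · rintro f rfl
    exact ⟨_, isHomogeneous_asmForm hq⟩
  · rw [← ker_planePoint hq]; exact isPrime_ker_planePoint hq hc
  · rw [← ker_planePoint hq]; exact X_two_notMem_ker_planePoint hq hc

/-- Evaluating the quadratic forms of `τ` at `(xt, yt, t)` gives the generic point of the space
model with `t` replaced by `t²`. This substitution is injective, so the two kernels correspond under
`τ`. -/
theorem planePoint_comp_asmTau :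
    (planePoint q c).comp (aeval (asmTau K)) =
      ((Polynomial.expand (AffineRing q c) 2).restrictScalars K).comp (spacePoint q c) := by
  ext1 i
  fin_cases i <;> simp [planePoint, spacePoint, asmTau] <;> ring

theorem comap_asmTau :
    (RingHom.ker (planePoint q c)).comap (aeval (asmTau K)) = RingHom.ker (spacePoint q c) := by
  ext g
  rw [Ideal.mem_comap, RingHom.mem_ker, RingHom.mem_ker]
  have := DFunLike.congr_fun (planePoint_comp_asmTau (q := q) (c := c)) g
  rw [AlgHom.comp_apply, AlgHom.comp_apply] at this
  rw [this, AlgHom.restrictScalars_apply, Polynomial.expand_eq_zero (by norm_num)]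

theorem projIdeal_space [IsAlgClosed K] (hq : 2 ≤ q) (hc : c ≠ 0) :
    projIdeal (projImage (asmTau K) (projZeroLocus {asmForm q c})) =
      RingHom.ker (spacePoint q c) := by
  have hP := isPrime_ker_planePoint hq hc
  rw [projIdeal_projImage two_ne_zero isHomogeneous_asmTau (l := 3), projIdeal_plane hq hc,
    comap_asmTau]
  · rwa [projIdeal_plane hq hc]
  · rw [projIdeal_plane hq hc]
    have := X_two_notMem_ker_planePoint hq hc
    intro h
    exact this (hP.mem_of_pow_mem 2 h)

theorem projClosure_space [IsAlgClosed K] (hq : 2 ≤ q) (hc : c ≠ 0) :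
    projClosure (projImage (asmTau K) (projZeroLocus {asmForm q c})) =
      projZeroLocus {quadricForm K, surfaceForm q c} := by
  rw [projClosure, projIdeal_space hq hc, ker_spacePoint hq, projZeroLocus_span]

end Curves

/-! ### Dimension of the cones, and the two curves. -/

section Dimension

variable {K : Type*} [Field K] {q : ℕ} {c : K}

theorem of_injective (hq : 2 ≤ q) : Function.Injective (AdjoinRoot.of (affinePoly q c)) := by
  apply AdjoinRoot.of.injective_of_degree_ne_zero
  intro h
  have := natDegree_affinePoly (c := c) hq
  rw [Polynomial.natDegree_eq_zero_iff_degree_le_zero.2 h.le] at this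
  omega

theorem affine_induction {p : AffineRing q c → Prop} (hC : ∀ a : K, p (algebraMap K _ a))
    (hx : p (affX q c)) (hy : p (affY q c)) (hadd : ∀ a b, p a → p b → p (a + b))
    (hmul : ∀ a b, p a → p b → p (a * b)) (b : AffineRing q c) : p b := by
  have hpow : ∀ a, p a → ∀ n : ℕ, p (a ^ n) := by
    intro a ha n
    induction n with
    | zero => simpa using hC 1
    | succ n ih => rw [pow_succ]; exact hmul _ _ ih ha
  have hof : ∀ g : Polynomial K, p (AdjoinRoot.of _ g) := by
    intro g
    induction g using Polynomial.induction_on' with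
    | add f g hf hg => rw [map_add]; exact hadd _ _ hf hg
    | monomial n a =>
      rw [← Polynomial.C_mul_X_pow_eq_monomial, map_mul, map_pow]
      exact hmul _ _ (hC a) (hpow _ hx n)
  obtain ⟨g, rfl⟩ := AdjoinRoot.mk_surjective b
  induction g using Polynomial.induction_on' with
  | add f g hf hg => rw [map_add]; exact hadd _ _ hf hg
  | monomial n a =>
    rw [← Polynomial.C_mul_X_pow_eq_monomial, map_mul, map_pow, AdjoinRoot.mk_C, AdjoinRoot.mk_X]
    exact hmul _ _ (hof a) (hpow _ hy n)

theorem trdeg_affineRing (hq : 2 ≤ q) (hc : c ≠ 0) : Algebra.trdeg K (AffineRing q c) = 1 := by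
  have := isDomain_affineRing hq hc
  have : FaithfulSMul (Polynomial K) (AffineRing q c) :=
    (faithfulSMul_iff_algebraMap_injective _ _).2 (of_injective hq)
  have halg : Algebra.IsAlgebraic (Polynomial K) (AffineRing q c) := by
    refine ⟨fun b => ?_⟩
    refine affine_induction (p := IsAlgebraic (Polynomial K)) ?_ ?_ ?_ (fun _ _ => IsAlgebraic.add)
      (fun _ _ => IsAlgebraic.mul) b
    · exact fun a => isAlgebraic_algebraMap (Polynomial.C a)
    · exact isAlgebraic_algebraMap (Polynomial.X : Polynomial K)
    · exact AdjoinRoot.isAlgebraic_root (prime_affinePoly hq hc).ne_zero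
  have h := trdeg_add_eq K (Polynomial K) (A := AffineRing q c)
  rw [trdeg_eq_zero (R := Polynomial K), Polynomial.trdeg_of_isDomain, add_zero] at h
  exact h.symm

theorem trdeg_coneRing (hq : 2 ≤ q) (hc : c ≠ 0) :
    Algebra.trdeg K (Polynomial (AffineRing q c)) = 2 := by
  have := isDomain_affineRing hq hc
  rw [← trdeg_add_eq K (AffineRing q c), trdeg_affineRing hq hc,
    Polynomial.trdeg_of_isDomain, one_add_one_eq_two]

/-- The range of `φ` contains `t`, `xt` and `yt`, so all of `R[t]` is algebraic over it and has the
same transcendence degree. -/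
theorem trdeg_quotient_ker (hq : 2 ≤ q) (hc : c ≠ 0) {n : ℕ}
    (φ : MvPolynomial (Fin n) K →ₐ[K] Polynomial (AffineRing q c))
    (hx : Polynomial.C (affX q c) * Polynomial.X ∈ φ.range)
    (hy : Polynomial.C (affY q c) * Polynomial.X ∈ φ.range) (ht : Polynomial.X ∈ φ.range) :
    Algebra.trdeg K (MvPolynomial (Fin n) K ⧸ RingHom.ker φ) = 2 := by
  have := isDomain_affineRing hq hc
  have hX : IsAlgebraic φ.range (Polynomial.X : Polynomial (AffineRing q c)) :=
    isAlgebraic_algebraMap (⟨_, ht⟩ : φ.range)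
  have hX0 : (Polynomial.X : Polynomial (AffineRing q c)) ∈ nonZeroDivisors _ :=
    mem_nonZeroDivisors_of_ne_zero Polynomial.X_ne_zero
  have hmul : ∀ a : AffineRing q c, Polynomial.C a * Polynomial.X ∈ φ.range →
      IsAlgebraic φ.range (Polynomial.C a) := fun a ha =>
    IsAlgebraic.of_mul hX0 hX (by
      rw [mul_comm]; exact isAlgebraic_algebraMap (⟨_, ha⟩ : φ.range))
  have hCalg : ∀ b : AffineRing q c, IsAlgebraic φ.range (Polynomial.C b) := fun b => by
    refine affine_induction (p := fun b => IsAlgebraic φ.range (Polynomial.C b)) (fun a => ?_)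
      (hmul _ hx) (hmul _ hy) (fun a b ha hb => ?_) (fun a b ha hb => ?_) b
    · exact isAlgebraic_algebraMap (algebraMap K φ.range a)
    · rw [map_add]; exact ha.add hb
    · rw [map_mul]; exact ha.mul hb
  have halg : Algebra.IsAlgebraic φ.range (Polynomial (AffineRing q c)) := by
    refine ⟨fun p => ?_⟩
    induction p using Polynomial.induction_on' with
    | add f g hf hg => exact hf.add hg
    | monomial n a =>
      rw [← Polynomial.C_mul_X_pow_eq_monomial]
      exact (hCalg a).mul (hX.pow n)
  have : FaithfulSMul K φ.range :=
    (faithfulSMul_iff_algebraMap_injective _ _).2 (algebraMap K φ.range).injective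
  have h := trdeg_add_eq K φ.range (A := Polynomial (AffineRing q c))
  rw [trdeg_eq_zero (R := φ.range), trdeg_coneRing hq hc, add_zero] at h
  rw [← h]
  have e := (Ideal.quotientKerEquivRange φ).lift_trdeg_eq
  simpa using e

theorem trdeg_plane (hq : 2 ≤ q) (hc : c ≠ 0) :
    Algebra.trdeg K (MvPolynomial (Fin 3) K ⧸ RingHom.ker (planePoint q c)) = 2 :=
  trdeg_quotient_ker hq hc _ ⟨X 0, by simp [planePoint]⟩ ⟨X 1, by simp [planePoint]⟩
    ⟨X 2, by simp [planePoint]⟩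

theorem trdeg_space (hq : 2 ≤ q) (hc : c ≠ 0) :
    Algebra.trdeg K (MvPolynomial (Fin 4) K ⧸ RingHom.ker (spacePoint q c)) = 2 :=
  trdeg_quotient_ker hq hc _ ⟨X 0, by simp [spacePoint]⟩ ⟨X 1, by simp [spacePoint]⟩
    ⟨X 3, by simp [spacePoint]⟩

variable [IsAlgClosed K]

/-- The plane model of the Artin-Schreier-Mumford curve. -/
noncomputable def planeCurve (hq : 2 ≤ q) (hc : c ≠ 0) : ProjCurve K 2 where
  carrier := projZeroLocus {asmForm q c}
  closed := projClosure_projZeroLocus _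
  prime := by
    rw [projIdeal_plane hq hc]; exact isPrime_ker_planePoint hq hc
  dim_one := by
    rw [projIdeal_plane hq hc]; exact trdeg_plane hq hc

/-- The model of the Artin-Schreier-Mumford curve in three-space. -/
noncomputable def spaceCurve (hq : 2 ≤ q) (hc : c ≠ 0) : ProjCurve K 3 where
  carrier := projClosure (projImage (asmTau K) (projZeroLocus {asmForm q c}))
  closed := projClosure_projClosure _
  prime := by
    rw [projIdeal_projClosure, projIdeal_space hq hc]; exact isPrime_ker_spacePoint hq hc
  dim_one := by
    rw [projIdeal_projClosure, projIdeal_space hq hc]; exact trdeg_space hq hc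

theorem ideal_planeCurve (hq : 2 ≤ q) (hc : c ≠ 0) :
    (planeCurve hq hc).ideal = RingHom.ker (planePoint q c) :=
  projIdeal_plane hq hc

theorem ideal_spaceCurve (hq : 2 ≤ q) (hc : c ≠ 0) :
    (spaceCurve hq hc).ideal = RingHom.ker (spacePoint q c) := by
  rw [ProjCurve.ideal, spaceCurve, projIdeal_projClosure, projIdeal_space hq hc]

theorem carrier_spaceCurve (hq : 2 ≤ q) (hc : c ≠ 0) :
    (spaceCurve hq hc).carrier = projZeroLocus {quadricForm K, surfaceForm q c} :=
  projClosure_space hq hc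

theorem comap_ideal (hq : 2 ≤ q) (hc : c ≠ 0) :
    (planeCurve hq hc).ideal.comap (aeval (asmTau K)) = (spaceCurve hq hc).ideal := by
  rw [ideal_planeCurve, ideal_spaceCurve, comap_asmTau]

end Dimension

end ASM

namespace ProjCurve

/-! ### Function fields and the maps induced by forms. -/

section FunctionField

variable {K : Type*} [Field K] {n m : ℕ} (C : ProjCurve K n)

theorem aeval_homCoord (f : MvPolynomial (Fin (n + 1)) K) :
    aeval C.homCoord f = algebraMap C.CoordRing C.ConeField (Ideal.Quotient.mk C.ideal f) := by
  have : aeval C.homCoord = (IsScalarTower.toAlgHom K C.CoordRing C.ConeField).comp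
      (Ideal.Quotient.mkₐ K C.ideal) := by
    ext1 i
    simp [homCoord]
  rw [this]
  rfl

theorem aeval_homCoord_eq_zero {f : MvPolynomial (Fin (n + 1)) K} :
    aeval C.homCoord f = 0 ↔ f ∈ C.ideal := by
  rw [aeval_homCoord, IsFractionRing.to_map_eq_zero_iff, Ideal.Quotient.eq_zero_iff_mem]

theorem homCoord_ne_zero {l : Fin (n + 1)} (hl : X l ∉ C.ideal) : C.homCoord l ≠ 0 := by
  intro h
  apply hl
  rw [← aeval_homCoord_eq_zero, aeval_X, h]

theorem coe_ratio (i j : Fin (n + 1)) :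
    (C.ratio i j : C.ConeField) = C.homCoord i / C.homCoord j := rfl

theorem ratio_self {l : Fin (n + 1)} (hl : X l ∉ C.ideal) : C.ratio l l = 1 := by
  ext
  rw [coe_ratio, div_self (C.homCoord_ne_zero hl)]
  rfl

theorem dehom_X (i l : Fin (n + 1)) : C.dehom l (X i) = C.ratio i l := by
  simp [dehom]

theorem coe_dehom {l : Fin (n + 1)} {F : MvPolynomial (Fin (n + 1)) K} {d : ℕ}
    (hF : F.IsHomogeneous d) :
    (C.dehom l F : C.ConeField) = aeval C.homCoord F / C.homCoord l ^ d := by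
  have h1 : (C.dehom l F : C.ConeField) =
      aeval (fun i => C.homCoord i / C.homCoord l) F := by
    change C.functionField.val (aeval _ F) = _
    rw [← AlgHom.comp_apply, comp_aeval]
    rfl
  rw [h1, aeval_def, eval₂_eq, aeval_def, eval₂_eq, Finset.sum_div]
  refine Finset.sum_congr rfl fun s hs => ?_
  have h := hF (mem_support_iff.1 hs)
  rw [Finsupp.weight_apply, Finsupp.sum] at h
  simp only [Pi.one_apply, smul_eq_mul, mul_one] at h
  simp only [div_pow, Finset.prod_div_distrib]
  rw [Finset.prod_pow_eq_pow_sum, h, mul_div_assoc]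

theorem functionField_le {l : Fin (n + 1)} (hl : X l ∉ C.ideal)
    {S : IntermediateField K C.ConeField} (h : ∀ i, C.homCoord i / C.homCoord l ∈ S) :
    C.functionField ≤ S := by
  refine IntermediateField.adjoin_le_iff.2 ?_
  rintro _ ⟨⟨i, j⟩, rfl⟩
  have := S.div_mem (h i) (h j)
  rwa [div_div_div_cancel_right₀ (C.homCoord_ne_zero hl)] at this

theorem adjoin_ratio {l : Fin (n + 1)} (hl : X l ∉ C.ideal) {s : Set C.functionField}
    (h : ∀ i, C.ratio i l ∈ IntermediateField.adjoin K s) : IntermediateField.adjoin K s = ⊤ := by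
  rw [eq_top_iff]
  rintro z -
  have h1 : C.functionField ≤ (IntermediateField.adjoin K s).map C.functionField.val :=
    C.functionField_le hl fun i => ⟨_, h i, rfl⟩
  obtain ⟨w, hw, hwz⟩ := h1 z.2
  rwa [← Subtype.ext hwz]

/-- Forms of the same degree which pull the ideal of `Y` back to the ideal of `C` induce a
homomorphism of the fraction fields of the homogeneous coordinate rings. -/
theorem exists_coneField_hom {C : ProjCurve K n} {Y : ProjCurve K m}
    {F : Fin (m + 1) → MvPolynomial (Fin (n + 1)) K}
    (h : C.ideal.comap (aeval F) = Y.ideal) :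
    ∃ σ : Y.ConeField →ₐ[K] C.ConeField, ∀ i, σ (Y.homCoord i) = aeval C.homCoord (F i) := by
  let g : Y.CoordRing →ₐ[K] C.CoordRing :=
    Ideal.quotientMapₐ C.ideal (aeval F) (fun x hx => by rw [← h] at hx; exact hx)
  have hg : Function.Injective g := by
    rw [injective_iff_map_eq_zero]
    intro a ha
    obtain ⟨f, rfl⟩ := Ideal.Quotient.mk_surjective a
    rw [Ideal.Quotient.eq_zero_iff_mem, ← h, Ideal.mem_comap, ← Ideal.Quotient.eq_zero_iff_mem]
    exact ha
  let G : Y.CoordRing →ₐ[K] C.ConeField := (IsScalarTower.toAlgHom K C.CoordRing C.ConeField).comp g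
  have hG : Function.Injective G := (IsFractionRing.injective C.CoordRing C.ConeField).comp hg
  refine ⟨IsFractionRing.liftAlgHom hG, fun i => ?_⟩
  rw [homCoord, IsFractionRing.liftAlgHom_apply, IsFractionRing.lift_algebraMap, aeval_homCoord]
  change algebraMap C.CoordRing C.ConeField (g _) = _
  congr 1
  change Ideal.Quotient.mk _ (aeval F (X i)) = _
  rw [aeval_X]

/-- The power `X_l ^ d` separating a form from its dehomogenization cancels in quotients. Thus the
homomorphism of cone fields sends the generators of one function field to the quotients in `hgen`,
which generate the other. -/
theorem exists_functionField_equiv {C : ProjCurve K n} {Y : ProjCurve K m}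
    {F : Fin (m + 1) → MvPolynomial (Fin (n + 1)) K} {d : ℕ} (hd : ∀ i, (F i).IsHomogeneous d)
    (h : C.ideal.comap (aeval F) = Y.ideal) {l : Fin (n + 1)} (hl : X l ∉ C.ideal)
    (hgen : IntermediateField.adjoin K
      (Set.range fun ij : Fin (m + 1) × Fin (m + 1) => C.dehom l (F ij.1) / C.dehom l (F ij.2)) =
        ⊤) : ∃ e : Y.functionField ≃ₐ[K] C.functionField,
      ∀ i j, e (Y.ratio i j) = C.dehom l (F i) / C.dehom l (F j) := by
  obtain ⟨σ, hσ⟩ := exists_coneField_hom h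
  have key : ∀ i j, σ (Y.homCoord i / Y.homCoord j) =
      C.functionField.val (C.dehom l (F i) / C.dehom l (F j)) := by
    intro i j
    rw [map_div₀, map_div₀, hσ, hσ, IntermediateField.coe_val, C.coe_dehom (hd i),
      C.coe_dehom (hd j), div_div_div_cancel_right₀ (pow_ne_zero _ (C.homCoord_ne_zero hl))]
  have hmap : Y.functionField.map σ = C.functionField := by
    rw [functionField, IntermediateField.adjoin_map, ← Set.range_comp]
    have h1 : (σ ∘ fun ij : Fin (m + 1) × Fin (m + 1) => Y.homCoord ij.1 / Y.homCoord ij.2) =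
        C.functionField.val ∘ fun ij : Fin (m + 1) × Fin (m + 1) =>
          C.dehom l (F ij.1) / C.dehom l (F ij.2) := by
      ext1 ij
      exact key ij.1 ij.2
    rw [h1, Set.range_comp, ← IntermediateField.adjoin_map, hgen, ← AlgHom.fieldRange_eq_map,
      IntermediateField.fieldRange_val]
  refine ⟨(IntermediateField.equivMap Y.functionField σ).trans
    (IntermediateField.equivOfEq hmap), fun i j => ?_⟩
  ext
  exact key i j

end FunctionField

end ProjCurve

/-- The field `F` is the function field of the Artin-Schreier-Mumford curve over `K`, with `x` and
`y` as the affine coordinate functions. -/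
structure IsASMField (K : Type*) {F : Type*} [Field K] [Field F] [Algebra K F] (q : ℕ) (c : K)
    (x y : F) : Prop where
  relation : (x ^ q + x) * (y ^ q + y) = algebraMap K F c
  transcendental : Transcendental K x
  adjoin_eq_top : IntermediateField.adjoin K {x, y} = ⊤

theorem IsASMField.map {K F F' : Type*} [Field K] [Field F] [Algebra K F] [Field F'] [Algebra K F']
    {q : ℕ} {c : K} {x y : F} (h : IsASMField K q c x y) (e : F ≃ₐ[K] F') :
    IsASMField K q c (e x) (e y) where
  relation := by
    have := congrArg e h.relation
    simpa using this
  transcendental := by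
    have := h.transcendental
    rwa [Transcendental, ← isAlgebraic_algHom_iff e.toAlgHom e.injective] at this
  adjoin_eq_top := by
    have := congrArg (IntermediateField.map e.toAlgHom) h.adjoin_eq_top
    rw [IntermediateField.adjoin_map, Set.image_pair, ← AlgHom.fieldRange_eq_map] at this
    rw [← (AlgHom.fieldRange_eq_top (f := e.toAlgHom)).2 e.surjective]
    exact this

namespace ASM

/-! ### The function field common to both models. -/

section FunctionField

variable {K : Type*} [Field K] {q : ℕ} {c : K}

theorem affX_ne_algebraMap (hq : 2 ≤ q) (a : K) : affX q c ≠ algebraMap K _ a := by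
  intro h
  have := of_injective (c := c) hq h
  have h2 := congrArg Polynomial.natDegree this
  simp at h2

variable [IsAlgClosed K]

theorem X_two_notMem_ideal (hq : 2 ≤ q) (hc : c ≠ 0) : X 2 ∉ (planeCurve hq hc).ideal := by
  rw [ideal_planeCurve]
  exact X_two_notMem_ker_planePoint hq hc

theorem X_three_notMem_ideal (hq : 2 ≤ q) (hc : c ≠ 0) : X 3 ∉ (spaceCurve hq hc).ideal := by
  have := isDomain_affineRing hq hc
  rw [ideal_spaceCurve]
  simp [spacePoint, RingHom.mem_ker]

theorem mem_range_of_isAlgebraic {F : Type*} [Field F] [Algebra K F] {x : F}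
    (h : IsAlgebraic K x) : ∃ a, algebraMap K F a = x := by
  have hx := h.isIntegral
  exact minpoly.mem_range_of_degree_eq_one K x
    (IsAlgClosed.degree_eq_one_of_irreducible K (minpoly.irreducible hx))

theorem isASMField_planeCurve (hq : 2 ≤ q) (hc : c ≠ 0) :
    IsASMField K q c ((planeCurve hq hc).ratio 0 2) ((planeCurve hq hc).ratio 1 2) where
  relation := by
    have h : (planeCurve hq hc).dehom 2 (asmForm q c) = 0 := by
      ext
      rw [ProjCurve.coe_dehom _ (isHomogeneous_asmForm hq),
        (ProjCurve.aeval_homCoord_eq_zero _).2, zero_div]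
      · rfl
      · rw [ideal_planeCurve, RingHom.mem_ker]
        exact planePoint_asmForm hq
    rw [ProjCurve.dehom, asmForm] at h
    simpa [ProjCurve.ratio_self _ (X_two_notMem_ideal hq hc), sub_eq_zero] using h
  transcendental := by
    intro h
    -- Over an algebraically closed field, an algebraic `x` would be a constant `a`; the linear form
    -- `X₀ - aX₂` would then lie in the ideal, which its value at the generic point excludes.
    obtain ⟨a, ha⟩ := mem_range_of_isAlgebraic h
    have h1 : (planeCurve hq hc).dehom 2 (X 0 - C a * X 2) = 0 := by
      simp [ProjCurve.dehom, ProjCurve.ratio_self _ (X_two_notMem_ideal hq hc), ha]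
    have hom : (X 0 - C a * X 2 : MvPolynomial (Fin 3) K).IsHomogeneous 1 := by
      refine (isHomogeneous_X K 0).sub ?_
      simpa using (isHomogeneous_C (Fin 3) a).mul (isHomogeneous_X K (2 : Fin 3))
    have h2 := ProjCurve.coe_dehom (planeCurve hq hc) (l := 2) hom
    rw [h1, eq_comm, ZeroMemClass.coe_zero, div_eq_zero_iff] at h2
    have h3 := h2.resolve_right (pow_ne_zero _ (ProjCurve.homCoord_ne_zero _
      (X_two_notMem_ideal hq hc)))
    rw [ProjCurve.aeval_homCoord_eq_zero, ideal_planeCurve, RingHom.mem_ker] at h3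
    have h4 := congrArg (fun p => Polynomial.coeff p 1) h3
    have h5 : algebraMap K (Polynomial (AffineRing q c)) a = Polynomial.C (algebraMap K _ a) := rfl
    simp [planePoint, h5, sub_eq_zero] at h4
    exact affX_ne_algebraMap hq a h4
  adjoin_eq_top := by
    refine ProjCurve.adjoin_ratio _ (X_two_notMem_ideal hq hc) fun i => ?_
    fin_cases i
    · exact IntermediateField.subset_adjoin _ _ (by simp)
    · exact IntermediateField.subset_adjoin _ _ (by simp)
    · change (planeCurve hq hc).ratio 2 2 ∈ _
      rw [ProjCurve.ratio_self _ (X_two_notMem_ideal hq hc)]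
      exact one_mem _

theorem dehom_asmTau (hq : 2 ≤ q) (hc : c ≠ 0) (i : Fin 4) :
    (planeCurve hq hc).dehom 2 (asmTau K i) =
      (![(planeCurve hq hc).ratio 0 2, (planeCurve hq hc).ratio 1 2,
        (planeCurve hq hc).ratio 0 2 * (planeCurve hq hc).ratio 1 2, 1] :
          Fin 4 → (planeCurve hq hc).functionField) i := by
  have := ProjCurve.ratio_self _ (X_two_notMem_ideal hq hc)
  fin_cases i <;> simp [asmTau, ProjCurve.dehom, this]

theorem exists_asmTau_equiv (hq : 2 ≤ q) (hc : c ≠ 0) :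
    ∃ e : (spaceCurve hq hc).functionField ≃ₐ[K] (planeCurve hq hc).functionField,
      ∀ i j, e ((spaceCurve hq hc).ratio i j) =
        (planeCurve hq hc).dehom 2 (asmTau K i) / (planeCurve hq hc).dehom 2 (asmTau K j) := by
  refine ProjCurve.exists_functionField_equiv isHomogeneous_asmTau (comap_ideal hq hc)
    (X_two_notMem_ideal hq hc) ?_
  rw [eq_top_iff, ← (isASMField_planeCurve hq hc).adjoin_eq_top]
  refine IntermediateField.adjoin.mono _ _ _ ?_
  rintro z (rfl | rfl)
  · exact ⟨(0, 3), by simp [dehom_asmTau]⟩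
  · exact ⟨(1, 3), by simp [dehom_asmTau]⟩

theorem isBirationalVia_asmTau (hq : 2 ≤ q) (hc : c ≠ 0) :
    (planeCurve hq hc).IsBirationalVia (spaceCurve hq hc) (asmTau K) :=
  ⟨⟨2, isHomogeneous_asmTau⟩, 2, X_two_notMem_ideal hq hc, exists_asmTau_equiv hq hc⟩

/-- The functions `x` and `y` of the plane model are carried over by the birational isomorphism, so
both models enter the order computation in the same form. -/
theorem exists_isASMField_spaceCurve (hq : 2 ≤ q) (hc : c ≠ 0) :
    ∃ x y : (spaceCurve hq hc).functionField, IsASMField K q c x y ∧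
      ∀ i, (spaceCurve hq hc).dehom 3 (X i) = (![x, y, x * y, 1] : Fin 4 → _) i := by
  obtain ⟨e, he⟩ := exists_asmTau_equiv hq hc
  refine ⟨_, _, (isASMField_planeCurve hq hc).map e.symm, fun i => ?_⟩
  rw [ProjCurve.dehom_X]
  apply e.injective
  rw [he, dehom_asmTau, dehom_asmTau]
  fin_cases i <;> simp

end FunctionField

end ASM

/-! ### Existence of the Hasse expansion. -/

theorem PowerSeries.ker_constantCoeff_eq_span_X {R : Type*} [CommRing R] :
    RingHom.ker (PowerSeries.constantCoeff (R := R)) = Ideal.span {PowerSeries.X} := by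
  ext f
  rw [RingHom.mem_ker, Ideal.mem_span_singleton, PowerSeries.X_dvd_iff]

/-- A homomorphism from a field `L` to an adically complete ring extends to a separable extension
of `L` with values in the residue ring. -/
theorem exists_lift_of_isSeparable {L F S : Type*} [Field L] [Field F] [Algebra L F] [CommRing S]
    [Algebra.IsSeparable L F] (σ : L →+* S) (π : S →+* F) (hπ : Function.Surjective π)
    [IsAdicComplete (RingHom.ker π) S] (h : π.comp σ = algebraMap L F) :
    ∃ E : F →+* S, E.comp (algebraMap L F) = σ ∧ π.comp E = RingHom.id F := by
  let _ : Algebra L S := σ.toAlgebra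
  -- Separable algebraic field extensions are formally étale, so the identity of the residue field
  -- lifts to the complete ring.
  have : Algebra.FormallyEtale L F := Algebra.FormallyEtale.of_isSeparable L F
  let π' : S →ₐ[L] F := { π with commutes' := fun a => DFunLike.congr_fun h a }
  obtain ⟨E, hE⟩ := Algebra.FormallySmooth.exists_mkₐ_comp_eq_of_isAdicComplete
    (I := RingHom.ker π)
    (Ideal.quotientKerAlgEquivOfSurjective (f := π') hπ).symm.toAlgHom
  refine ⟨E, ?_, ?_⟩
  · ext a
    exact E.commutes a
  · ext a
    have h1 := DFunLike.congr_fun hE a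
    have h2 := congrArg (Ideal.quotientKerAlgEquivOfSurjective (f := π') hπ) h1
    exact h2.trans (AlgEquiv.apply_symm_apply _ a)

/-- The substitution `x ↦ x + T` extends from polynomials to rational functions: a nonzero `g(x +
T)` has constant term `g(x) ≠ 0`, hence is a unit. -/
theorem exists_adjoin_simple_lift {K F : Type*} [Field K] [Field F] [Algebra K F] {x : F}
    (hx : Transcendental K x) :
    ∃ σ : K⟮x⟯ →ₐ[K] PowerSeries F,
      σ (IntermediateField.AdjoinSimple.gen K x) = PowerSeries.C x + PowerSeries.X ∧
      ∀ a, PowerSeries.constantCoeff (σ a) = a := by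
  let π : PowerSeries F →ₐ[K] F :=
    { PowerSeries.constantCoeff (R := F) with
      commutes' := fun a => by
        rw [PowerSeries.algebraMap_apply]
        exact PowerSeries.constantCoeff_C _ }
  have hπ : ∀ f, π f = PowerSeries.constantCoeff f := fun f => rfl
  let τ : Polynomial K →ₐ[K] PowerSeries F := Polynomial.aeval (PowerSeries.C x + PowerSeries.X)
  have hτ : π.comp τ = Polynomial.aeval x := by
    ext
    simp [τ, hπ]
  have hunit : ∀ g : nonZeroDivisors (Polynomial K), IsUnit (τ g) := by
    intro g
    rw [PowerSeries.isUnit_iff_constantCoeff, ← hπ, ← AlgHom.comp_apply, hτ, isUnit_iff_ne_zero]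
    intro h
    exact nonZeroDivisors.coe_ne_zero g (transcendental_iff.1 hx _ h)
  let τ' : RatFunc K →ₐ[K] PowerSeries F := IsLocalization.liftAlgHom hunit
  let e := RatFunc.algEquivOfTranscendental x hx
  have hgen : e.symm (IntermediateField.AdjoinSimple.gen K x) =
      algebraMap (Polynomial K) (RatFunc K) Polynomial.X := by
    rw [AlgEquiv.symm_apply_eq, RatFunc.algEquivOfTranscendental_algebraMap, Polynomial.aeval_X]
  have h1 : τ' (e.symm (IntermediateField.AdjoinSimple.gen K x)) =
      PowerSeries.C x + PowerSeries.X := by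
    rw [hgen, IsLocalization.liftAlgHom_apply, IsLocalization.lift_eq]
    exact Polynomial.aeval_X _
  refine ⟨τ'.comp e.symm.toAlgHom, h1, fun a => ?_⟩
  have h2 : π.comp (τ'.comp e.symm.toAlgHom) = K⟮x⟯.val := by
    refine IntermediateField.adjoin_algHom_ext K fun z hz => ?_
    obtain rfl : z = x := hz
    change π (τ' (e.symm (IntermediateField.AdjoinSimple.gen K z))) = z
    rw [h1, hπ]
    simp
  exact DFunLike.congr_fun h2 a

namespace IsASMField

variable {K F : Type*} [Field K] [Field F] [Algebra K F] {p k q : ℕ} {c : K} {x y : F}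

theorem mul_ne_zero (h : IsASMField K q c x y) (hc : c ≠ 0) :
    (x ^ q + x) * (y ^ q + y) ≠ 0 := by
  rw [h.relation]
  simpa using hc

/-- Over `K(x)`, `y` is a root of `Z^q + Z - c/(x^q + x)`, whose derivative is `1` in characteristic
`p`. -/
theorem isSeparable (h : IsASMField K q c x y) (hc : c ≠ 0) [Fact p.Prime] [CharP K p]
    (hk : k ≠ 0) (hq : q = p ^ k) : Algebra.IsSeparable K⟮x⟯ F := by
  rw [← separableClosure.eq_top_iff]
  have hF : CharP F p := charP_of_injective_algebraMap (algebraMap K F).injective p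
  have hL : CharP K⟮x⟯ p := charP_of_injective_algebraMap (algebraMap K K⟮x⟯).injective p
  have hu : x ^ q + x ≠ 0 := left_ne_zero_of_mul (h.mul_ne_zero hc)
  have hx : x ∈ K⟮x⟯ := IntermediateField.mem_adjoin_simple_self K x
  let b : K⟮x⟯ := ⟨algebraMap K F c / (x ^ q + x),
    div_mem (IntermediateField.algebraMap_mem _ _) (add_mem (pow_mem hx q) hx)⟩
  let P : Polynomial K⟮x⟯ := Polynomial.X ^ q + Polynomial.X - Polynomial.C b
  have hq0 : (q : K⟮x⟯) = 0 := by
    rw [hq, Nat.cast_pow, CharP.cast_eq_zero, zero_pow hk]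
  have hP : P.Separable := by
    rw [Polynomial.separable_def]
    have : Polynomial.derivative P = 1 := by
      simp [P, Polynomial.derivative_X_pow, hq0]
    rw [this]
    exact isCoprime_one_right
  have hy : IsSeparable K⟮x⟯ y := by
    refine hP.of_dvd (minpoly.dvd _ _ ?_)
    have h1 : algebraMap K⟮x⟯ F b = algebraMap K F c / (x ^ q + x) := rfl
    rw [map_sub, map_add, map_pow, Polynomial.aeval_X, Polynomial.aeval_C, h1, ← h.relation,
      mul_div_cancel_left₀ _ hu, sub_self]
  have hle : IntermediateField.adjoin K {x, y} ≤
      (separableClosure K⟮x⟯ F).restrictScalars K := by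
    rw [IntermediateField.adjoin_le_iff]
    rintro z (rfl | rfl)
    · exact (separableClosure K⟮z⟯ F).algebraMap_mem ⟨z, hx⟩
    · exact mem_separableClosure_iff.2 hy
  rw [h.adjoin_eq_top] at hle
  rw [eq_top_iff]
  exact fun z _ => hle (show z ∈ (⊤ : IntermediateField K F) from trivial)

theorem exists_hasseExpansion (h : IsASMField K q c x y) (hc : c ≠ 0) [Fact p.Prime] [CharP K p]
    (hk : k ≠ 0) (hq : q = p ^ k) : ∃ E : F →ₐ[K] PowerSeries F,
      (∀ a, PowerSeries.constantCoeff (E a) = a) ∧ E x = PowerSeries.C x + PowerSeries.X := by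
  have := h.isSeparable hc hk hq
  obtain ⟨σ, hσ, hσ'⟩ := exists_adjoin_simple_lift h.transcendental
  have : IsAdicComplete (RingHom.ker (PowerSeries.constantCoeff (R := F))) (PowerSeries F) := by
    rw [PowerSeries.ker_constantCoeff_eq_span_X]
    infer_instance
  obtain ⟨E, hE, hE'⟩ := exists_lift_of_isSeparable σ.toRingHom
    (PowerSeries.constantCoeff (R := F)) PowerSeries.constantCoeff_surj
    (RingHom.ext fun a => hσ' a)
  have hE2 : ∀ a : K⟮x⟯, E (algebraMap K⟮x⟯ F a) = σ a := fun a => DFunLike.congr_fun hE a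
  refine ⟨{ E with commutes' := fun a => ?_ }, fun a => DFunLike.congr_fun hE' a, ?_⟩
  · exact (hE2 (algebraMap K K⟮x⟯ a)).trans (σ.commutes a)
  · exact (hE2 (IntermediateField.AdjoinSimple.gen K x)).trans hσ

end IsASMField

/-- If `f = a + T g` with `a` constant, then `f^q = a^q + T^q g^q` in characteristic `p`. -/
theorem PowerSeries.coeff_pow_expChar_pow {F : Type*} [Field F] {p k q : ℕ} [Fact p.Prime]
    [CharP F p] (hq : q = p ^ k) (f : PowerSeries F) {n : ℕ} (hn : n ≠ 0) (hnq : n ≤ q) :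
    PowerSeries.coeff n (f ^ q) = if n = q then PowerSeries.coeff 1 f ^ q else 0 := by
  have : CharP (PowerSeries F) p :=
    charP_of_injective_algebraMap (FaithfulSMul.algebraMap_injective F (PowerSeries F)) p
  obtain ⟨g, hg⟩ : ∃ g, f = PowerSeries.C (PowerSeries.constantCoeff f) + PowerSeries.X * g := by
    have h1 : PowerSeries.X ∣ f - PowerSeries.C (PowerSeries.constantCoeff f) := by
      rw [PowerSeries.X_dvd_iff]; simp
    obtain ⟨g, hg⟩ := h1
    exact ⟨g, by rw [← hg]; ring⟩
  have h1 : PowerSeries.coeff 1 f = PowerSeries.constantCoeff g := by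
    rw [hg]
    simp
  have h2 : f ^ q = PowerSeries.C (PowerSeries.constantCoeff f) ^ q + PowerSeries.X ^ q * g ^ q := by
    conv_lhs => rw [hg]
    rw [hq, add_pow_char_pow, mul_pow]
  rw [h2, h1, map_add, ← map_pow, PowerSeries.coeff_C, if_neg hn, zero_add,
    PowerSeries.coeff_X_pow_mul']
  split_ifs with h3 h4 h4
  · subst h4; simp
  · omega
  · omega
  · rfl

theorem det_order_matrix {R : Type*} [CommRing R] (x y a b b' d d' : R) :
    (!![x, y, x * y, 1; 1, a, x * a + y, 0; 0, b, x * b + b', 0; 0, d, x * d + d', 0] :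
      Matrix (Fin 4) (Fin 4) R).det = d * b' - b * d' := by
  simp [Matrix.det_succ_row_zero, Fin.sum_univ_succ, Fin.succAbove]
  ring

theorem det_frobenius_matrix {R : Type*} [CommRing R] (X Y x y a b b' : R) :
    (!![X, Y, X * Y, 1; x, y, x * y, 1; 1, a, x * a + y, 0; 0, b, x * b + b', 0] :
      Matrix (Fin 4) (Fin 4) R).det =
        b' * ((X - x) * a - (Y - y)) + (X - x) * (Y - y) * b := by
  simp [Matrix.det_succ_row_zero, Fin.sum_univ_succ, Fin.succAbove]
  ring

/-! ### Hasse derivatives of `y` and the order determinants. -/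

namespace IsASMField

variable {K F : Type*} [Field K] [Field F] [Algebra K F] {p k q : ℕ} {c : K} {x y : F}

section Coefficients

variable (h : IsASMField K q c x y) (hc : c ≠ 0) [Fact p.Prime] [CharP K p]
  (hq : q = p ^ k) {E : F →ₐ[K] PowerSeries F}
  (hE : ∀ a, PowerSeries.constantCoeff (E a) = a) (hx : E x = PowerSeries.C x + PowerSeries.X)

-- This compares the coefficients of `T^n` in `(x^q + x + T + T^q) · E(y^q + y) = c`; the term from
-- `T^q` enters only at `n = q`.
include h hq hE hx in
theorem coeff_relation {n : ℕ} (hn : n ≠ 0) (hnq : n ≤ q) :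
    (x ^ q + x) * PowerSeries.coeff n (E (y ^ q + y)) +
      PowerSeries.coeff (n - 1) (E (y ^ q + y)) + (if n = q then y ^ q + y else 0) = 0 := by
  have hF : CharP F p := charP_of_injective_algebraMap (algebraMap K F).injective p
  have : CharP (PowerSeries F) p :=
    charP_of_injective_algebraMap (FaithfulSMul.algebraMap_injective F (PowerSeries F)) p
  have h1 := congrArg E h.relation
  have h2 : E (x ^ q + x) = PowerSeries.C (x ^ q + x) + PowerSeries.X + PowerSeries.X ^ q := by
    rw [map_add, map_pow, hx, hq, add_pow_char_pow, map_add, map_pow]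
    ring
  rw [map_mul, h2, AlgHom.commutes, PowerSeries.algebraMap_apply, add_mul, add_mul] at h1
  have h3 := congrArg (PowerSeries.coeff n) h1
  obtain ⟨m, rfl⟩ := Nat.exists_eq_succ_of_ne_zero hn
  rw [map_add, map_add, PowerSeries.coeff_C_mul, PowerSeries.coeff_X_pow_mul',
    Nat.succ_eq_add_one, PowerSeries.coeff_succ_X_mul, PowerSeries.coeff_C,
    if_neg (Nat.succ_ne_zero m)] at h3
  have e : (if m + 1 = q then y ^ q + y else 0) =
      if q ≤ m + 1 then PowerSeries.coeff (m + 1 - q) (E (y ^ q + y)) else 0 := by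
    split_ifs with h4 h5 h5
    · rw [h4, Nat.sub_self, PowerSeries.coeff_zero_eq_constantCoeff_apply, hE]
    · omega
    · omega
    · rfl
  rw [Nat.succ_eq_add_one, e, Nat.add_sub_cancel]
  exact h3

include hE in
theorem coeff_zero_hasse (a : F) : PowerSeries.coeff 0 (E a) = a := by
  rw [PowerSeries.coeff_zero_eq_constantCoeff_apply, hE]

include hq in
theorem coeff_hasse_pow_add (n : ℕ) (hn : n ≠ 0) (hnq : n ≤ q) :
    PowerSeries.coeff n (E (y ^ q + y)) =
      PowerSeries.coeff n (E y) + if n = q then PowerSeries.coeff 1 (E y) ^ q else 0 := by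
  have hF : CharP F p := charP_of_injective_algebraMap (algebraMap K F).injective p
  rw [map_add, map_add, map_pow, PowerSeries.coeff_pow_expChar_pow hq _ hn hnq, add_comm]

include h hq hE hx in
theorem coeff_hasse_one (h2 : 2 ≤ q) :
    (x ^ q + x) * PowerSeries.coeff 1 (E y) = -(y ^ q + y) := by
  have h1 := h.coeff_relation hq hE hx one_ne_zero (by omega)
  rw [coeff_hasse_pow_add hq 1 one_ne_zero (by omega), if_neg (by omega), if_neg (by omega),
    Nat.sub_self, coeff_zero_hasse hE] at h1
  linear_combination h1

include h hq hE hx in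
theorem coeff_hasse_of_lt {n : ℕ} (hn : 2 ≤ n) (hnq : n < q) :
    (x ^ q + x) * PowerSeries.coeff n (E y) = -PowerSeries.coeff (n - 1) (E y) := by
  have h1 := h.coeff_relation hq hE hx (n := n) (by omega) (by omega)
  rw [coeff_hasse_pow_add hq n (by omega) (by omega),
    coeff_hasse_pow_add hq (n - 1) (by omega) (by omega), if_neg (by omega), if_neg (by omega),
    if_neg (by omega)] at h1
  linear_combination h1

include h hq hE hx in
theorem coeff_hasse_self (h3 : 2 ≤ q) :
    (x ^ q + x) * (PowerSeries.coeff q (E y) + PowerSeries.coeff 1 (E y) ^ q) =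
      -(PowerSeries.coeff (q - 1) (E y) + (y ^ q + y)) := by
  have h1 := h.coeff_relation hq hE hx (n := q) (by omega) le_rfl
  rw [coeff_hasse_pow_add hq q (by omega) le_rfl,
    coeff_hasse_pow_add hq (q - 1) (by omega) (by omega), if_pos rfl, if_pos rfl,
    if_neg (by omega)] at h1
  linear_combination h1

end Coefficients

section Transcendence

theorem not_isAlgebraic_relation (h : IsASMField K q c x y) (h2 : 2 ≤ q) :
    ¬ IsAlgebraic K (x ^ q + x) := by
  intro ha
  have hn := ASM.natDegree_pow_add_X (R := K) h2
  refine h.transcendental (IsAlgebraic.of_aeval (Polynomial.X ^ q + Polynomial.X)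
    (by omega) ?_ (by simpa using ha))
  rw [mem_nonZeroDivisors_iff_ne_zero, Polynomial.leadingCoeff_ne_zero]
  exact ASM.pow_add_X_ne_zero h2

theorem isAlgebraic_of_pow_eq_self {a : F} {Q : ℕ} (hQ : 2 ≤ Q) (ha : a ^ Q = a) :
    IsAlgebraic K a := by
  refine ⟨Polynomial.X ^ Q - Polynomial.X, ?_, by simp [ha]⟩
  intro h0
  have := congrArg (fun f => Polynomial.coeff f Q) h0
  simp [Polynomial.coeff_X, show ¬ 1 = Q by omega] at this

theorem x_pow_ne_self (h : IsASMField K q c x y) {Q : ℕ} (hQ : 2 ≤ Q) : x ^ Q ≠ x :=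
  fun hx => h.transcendental (isAlgebraic_of_pow_eq_self hQ hx)

theorem y_pow_ne_self (h : IsASMField K q c x y) (hc : c ≠ 0) (h2 : 2 ≤ q) {Q : ℕ} (hQ : 2 ≤ Q) :
    y ^ Q ≠ y := by
  intro hy
  have h1 : IsAlgebraic K y := isAlgebraic_of_pow_eq_self hQ hy
  have h3 : IsAlgebraic K (y ^ q + y) := (h1.pow q).add h1
  apply h.not_isAlgebraic_relation h2
  have h0 := right_ne_zero_of_mul (h.mul_ne_zero hc)
  rw [eq_div_of_mul_eq h0 h.relation, div_eq_mul_inv]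
  exact (isAlgebraic_algebraMap c).mul h3.inv

/-- An element fixed by the `q`-th power is algebraic over `K`. Here `y₁ = -c/(x^q + x)^2`, and `x^q
+ x` is transcendental. -/
theorem hasse_one_pow_ne_self (h : IsASMField K q c x y) (hc : c ≠ 0) (h2 : 2 ≤ q) {y₁ : F}
    (hy : (x ^ q + x) * y₁ = -(y ^ q + y)) : y₁ ^ q ≠ y₁ := by
  intro h1
  have halg : IsAlgebraic K y₁ := isAlgebraic_of_pow_eq_self h2 h1
  have h0 := h.mul_ne_zero hc
  have hu := left_ne_zero_of_mul h0
  have hv := right_ne_zero_of_mul h0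
  have hy0 : y₁ ≠ 0 := by
    rintro rfl
    rw [mul_zero, zero_eq_neg] at hy
    exact hv hy
  apply h.not_isAlgebraic_relation h2
  refine IsAlgebraic.of_pow two_pos ?_
  have h3 : (x ^ q + x) ^ 2 = -algebraMap K F c * y₁⁻¹ := by
    rw [eq_mul_inv_iff_mul_eq₀ hy0]
    linear_combination (x ^ q + x) * hy - h.relation
  rw [h3]
  exact (isAlgebraic_algebraMap c).neg.mul halg.inv

end Transcendence

section Orders

variable (h : IsASMField K q c x y) (hc : c ≠ 0) [Fact p.Prime] [CharP K p]
  (hq : q = p ^ k) {E : F →ₐ[K] PowerSeries F}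
  (hE : ∀ a, PowerSeries.constantCoeff (E a) = a) (hx : E x = PowerSeries.C x + PowerSeries.X)

-- The third entry is the product rule for `xy`, in which `E x = x + T` leaves only two terms.
include hE hx in
theorem hasse_rows (n : ℕ) :
    (fun j => PowerSeries.coeff n (E ((![x, y, x * y, 1] : Fin 4 → F) j))) =
      ![(if n = 0 then x else 0) + (if n = 1 then 1 else 0), PowerSeries.coeff n (E y),
        x * PowerSeries.coeff n (E y) + (if n = 0 then 0 else PowerSeries.coeff (n - 1) (E y)),
        if n = 0 then 1 else 0] := by
  ext j
  fin_cases j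
  · simp [hx, PowerSeries.coeff_C, PowerSeries.coeff_X]
  · simp
  · rcases n with _ | n
    · simp [hE]
    · simp [hx, add_mul, PowerSeries.coeff_succ_X_mul]
  · simp [PowerSeries.coeff_one]

include hE hx in
theorem hasse_det {i j : ℕ} (hi : 2 ≤ i) (hj : 2 ≤ j) :
    (Matrix.of fun a b => PowerSeries.coeff ((![0, 1, i, j] : Fin 4 → ℕ) a)
      (E ((![x, y, x * y, 1] : Fin 4 → F) b))).det =
      PowerSeries.coeff j (E y) * PowerSeries.coeff (i - 1) (E y) -
        PowerSeries.coeff i (E y) * PowerSeries.coeff (j - 1) (E y) := by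
  rw [← det_order_matrix x y (PowerSeries.coeff 1 (E y))]
  congr 1
  ext a b
  have := congrFun (hasse_rows (y := y) hE hx ((![0, 1, i, j] : Fin 4 → ℕ) a)) b
  rw [Matrix.of_apply, this]
  fin_cases a <;> fin_cases b <;>
    simp [hE, show i ≠ 0 by omega, show i ≠ 1 by omega, show j ≠ 0 by omega, show j ≠ 1 by omega]

-- A strictly increasing sequence below `(0, 1, 2, q)` can differ from it only in the last entry, so
-- only the determinants with orders `0, 1, 2, j`, `j ≤ q`, matter.
include h hc hq hE hx in
theorem isLexLeast_order (h3 : 3 ≤ q) :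
    ProjCurve.IsLexLeast (fun ε' : Fin 4 → ℕ => (Matrix.of fun i j =>
      PowerSeries.coeff (ε' i) (E ((![x, y, x * y, 1] : Fin 4 → F) j))).det ≠ 0) ![0, 1, 2, q] := by
  have hu : x ^ q + x ≠ 0 := left_ne_zero_of_mul (h.mul_ne_zero hc)
  have hv : y ^ q + y ≠ 0 := right_ne_zero_of_mul (h.mul_ne_zero hc)
  have h1 := h.coeff_hasse_one hq hE hx (by omega)
  refine ⟨?_, ?_, ?_⟩
  · rw [Fin.strictMono_iff_lt_succ]
    intro i
    fin_cases i
    · simp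
    · simp
    · simp; omega
  · dsimp only
    rw [hasse_det hE hx le_rfl (by omega)]
    have h4 := h.coeff_hasse_of_lt hq hE hx le_rfl h3
    have h5 := h.coeff_hasse_self hq hE hx (by omega)
    have h6 := h.hasse_one_pow_ne_self hc (by omega) h1
    intro h0
    rw [show 2 - 1 = 1 from rfl] at h0 h4
    set y₁ := PowerSeries.coeff 1 (E y)
    have hy0 : y₁ ≠ 0 := by
      intro h0
      rw [h0, mul_zero, zero_eq_neg] at h1
      exact hv h1
    -- Up to sign this is `x^q + x` times the determinant; the terms in `y_{q-1}` cancel.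
    have h7 : (x ^ q + x) * y₁ * (y₁ ^ q - y₁) = 0 := by
      linear_combination -(x ^ q + x) * h0 + y₁ * h5 - y₁ * h1 -
        PowerSeries.coeff (q - 1) (E y) * h4
    rcases mul_eq_zero.1 h7 with h8 | h8
    · exact _root_.mul_ne_zero hu hy0 h8
    · exact h6 (sub_eq_zero.1 h8)
  · intro ε hε hdet
    by_contra hlt
    rw [not_le] at hlt
    obtain ⟨i, hi, hlt⟩ := hlt
    have m1 : ε 0 < ε 1 := hε (by decide)
    have m2 : ε 1 < ε 2 := hε (by decide)
    have m3 : ε 2 < ε 3 := hε (by decide)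
    have e0 : 0 < i → ε 0 = 0 := fun h => hi 0 h
    have e1 : 1 < i → ε 1 = 1 := fun h => hi 1 h
    have e2 : 2 < i → ε 2 = 2 := fun h => hi 2 h
    fin_cases i
    · exact absurd (show ε 0 < 0 from hlt) (by omega)
    · have := e0 (by decide)
      exact absurd (show ε 1 < 1 from hlt) (by omega)
    · have := e1 (by decide)
      exact absurd (show ε 2 < 2 from hlt) (by omega)
    · have h0' := e0 (by decide)
      have h1' := e1 (by decide)
      have h2' := e2 (by decide)
      have h3' : ε 3 < q := hlt
      have hεe : ε = ![0, 1, 2, ε 3] := by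
        ext a
        fin_cases a
        · exact h0'
        · exact h1'
        · exact h2'
        · rfl
      apply hdet
      rw [hεe, hasse_det hE hx le_rfl (by omega)]
      have h4 := h.coeff_hasse_of_lt hq hE hx le_rfl h3
      have h5 := h.coeff_hasse_of_lt hq hE hx (n := ε 3) (by omega) h3'
      refine (mul_eq_zero.1 (?_ : (x ^ q + x) * _ = 0)).resolve_left hu
      -- Both `(x^q + x) y_2 = -y_1` and the same recursion at `ε 3` hold, so the two products in
      -- the determinant agree.
      linear_combination PowerSeries.coeff (2 - 1) (E y) * h5 -
        PowerSeries.coeff (ε 3 - 1) (E y) * h4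

include hE hx in
theorem frobenius_det {i Q : ℕ} (hi : 2 ≤ i) :
    (Matrix.of (Fin.cons (fun j => (![x, y, x * y, 1] : Fin 4 → F) j ^ Q)
        (fun i' j => PowerSeries.coeff ((![0, 1, i] : Fin 3 → ℕ) i')
          (E ((![x, y, x * y, 1] : Fin 4 → F) j))) : Fin 4 → Fin 4 → F)).det =
      PowerSeries.coeff (i - 1) (E y) *
        ((x ^ Q - x) * PowerSeries.coeff 1 (E y) - (y ^ Q - y)) +
        (x ^ Q - x) * (y ^ Q - y) * PowerSeries.coeff i (E y) := by
  rw [← det_frobenius_matrix]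
  congr 1
  ext a b
  rw [Matrix.of_apply]
  refine Fin.cases ?_ (fun a => ?_) a
  · fin_cases b <;> simp [mul_pow]
  · have := congrFun (hasse_rows (y := y) hE hx ((![0, 1, i] : Fin 3 → ℕ) a)) b
    rw [Fin.cons_succ, this]
    fin_cases a <;> fin_cases b <;>
      simp [hE, show i ≠ 0 by omega, show i ≠ 1 by omega]

include h hc hq hE hx in
theorem isLexLeast_frobenius (h3 : 3 ≤ q) (hcq : c ^ q = c) :
    ProjCurve.IsLexLeast (fun ν' : Fin 3 → ℕ =>
      (Matrix.of (Fin.cons (fun j => (![x, y, x * y, 1] : Fin 4 → F) j ^ q ^ 2)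
        (fun i j => PowerSeries.coeff (ν' i) (E ((![x, y, x * y, 1] : Fin 4 → F) j))) :
          Fin 4 → Fin 4 → F)).det ≠ 0) ![0, 1, q] := by
  have hF : CharP F p := charP_of_injective_algebraMap (algebraMap K F).injective p
  have hu : x ^ q + x ≠ 0 := left_ne_zero_of_mul (h.mul_ne_zero hc)
  have h1 := h.coeff_hasse_one hq hE hx (by omega)
  have hQ : 2 ≤ q ^ 2 := by nlinarith
  have hrel : ((x ^ q + x) * (y ^ q + y)) ^ q = (x ^ q + x) * (y ^ q + y) := by
    rw [h.relation, ← map_pow, hcq]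
  have hpow : ∀ z : F, (z ^ q + z) ^ q = z ^ q ^ 2 + z ^ q := by
    intro z
    conv_lhs => rw [hq, add_pow_char_pow, ← hq, ← pow_mul, ← pow_two]
  rw [mul_pow, hpow, hpow] at hrel
  refine ⟨?_, ?_, ?_⟩
  · rw [Fin.strictMono_iff_lt_succ]
    intro i
    fin_cases i
    · simp
    · simp; omega
  · dsimp only
    rw [frobenius_det hE hx (by omega)]
    have h5 := h.coeff_hasse_self hq hE hx (by omega)
    have h6 := h.hasse_one_pow_ne_self hc (by omega) h1
    have hA := sub_ne_zero.2 (h.x_pow_ne_self hQ)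
    have hB := sub_ne_zero.2 (h.y_pow_ne_self hc (by omega) hQ)
    intro h0
    set y₁ := PowerSeries.coeff 1 (E y)
    -- By `hrel` and `h1`, the bracket `A y₁ - B` of the determinant becomes `AB / (x^q + x)`. What
    -- remains is `AB (y_{q-1} + (x^q + x) y_q)`, and `h5` with `h1` evaluates the last factor.
    have h7 : (x ^ q ^ 2 - x) * (y ^ q ^ 2 - y) * ((x ^ q + x) * (y₁ ^ q - y₁)) = 0 := by
      linear_combination -(x ^ q + x) * h0 +
        (x ^ q ^ 2 - x) * (y ^ q ^ 2 - y) * (h5 - h1) -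
        PowerSeries.coeff (q - 1) (E y) * hrel +
        PowerSeries.coeff (q - 1) (E y) * (x ^ q ^ 2 - x) * h1
    exact (_root_.mul_ne_zero (_root_.mul_ne_zero hA hB)
      (_root_.mul_ne_zero hu (sub_ne_zero.2 h6))) h7
  · intro ε hε hdet
    by_contra hlt
    rw [not_le] at hlt
    obtain ⟨i, hi, hlt⟩ := hlt
    have m1 : ε 0 < ε 1 := hε (by decide)
    have m2 : ε 1 < ε 2 := hε (by decide)
    have e0 : 0 < i → ε 0 = 0 := fun h => hi 0 h
    have e1 : 1 < i → ε 1 = 1 := fun h => hi 1 h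
    fin_cases i
    · exact absurd (show ε 0 < 0 from hlt) (by omega)
    · have := e0 (by decide)
      exact absurd (show ε 1 < 1 from hlt) (by omega)
    · have h0' := e0 (by decide)
      have h1' := e1 (by decide)
      have h2' : ε 2 < q := hlt
      have hεe : ε = ![0, 1, ε 2] := by
        ext a
        fin_cases a
        · exact h0'
        · exact h1'
        · rfl
      apply hdet
      rw [hεe, frobenius_det hE hx (by omega)]
      have h5 := h.coeff_hasse_of_lt hq hE hx (n := ε 2) (by omega) h2'
      refine (mul_eq_zero.1 (?_ : (x ^ q + x) * _ = 0)).resolve_left hu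
      -- The same substitution leaves the factor `y_{i-1} + (x^q + x) y_i`, with `i = ε 2`, which
      -- the recursion `h5` kills.
      linear_combination (x ^ q ^ 2 - x) * (y ^ q ^ 2 - y) * h5 -
        PowerSeries.coeff (ε 2 - 1) (E y) * hrel +
        PowerSeries.coeff (ε 2 - 1) (E y) * (x ^ q ^ 2 - x) * h1

end Orders

end IsASMField

namespace ASM

/-! ### Hilbert function of the space model. -/

section Degree

variable {K : Type*} [Field K] [IsAlgClosed K] {q : ℕ} {c : K}

/-- The exponents `(i, j)` of the monomials `x^i y^j` that represent the reduced monomials of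
degree `s` on the space model. -/
def reducedIndex (q s : ℕ) : Finset (ℕ × ℕ) :=
  (Finset.range (s + 1) ×ˢ Finset.range (s + 1)) \
    (Finset.Ico q (s + 1) ×ˢ Finset.Ico q (s + 1))

theorem mem_reducedIndex {s : ℕ} {a : ℕ × ℕ} :
    a ∈ reducedIndex q s ↔ (a.1 ≤ s ∧ a.2 ≤ s) ∧ ¬ (q ≤ a.1 ∧ q ≤ a.2) := by
  simp only [reducedIndex, Finset.mem_sdiff, Finset.mem_product, Finset.mem_range, Finset.mem_Ico]
  omega

/-- The count is `(s + 1)^2 - (s + 1 - q)^2`. -/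
theorem card_reducedIndex {s : ℕ} (hs : q ≤ s) :
    ((reducedIndex q s).card : ℤ) = 2 * q * s + (2 * q - q ^ 2) := by
  rw [reducedIndex, Finset.card_sdiff_of_subset]
  · simp only [Finset.card_product, Finset.card_range, Nat.card_Ico]
    obtain ⟨d, rfl⟩ := Nat.exists_eq_add_of_le hs
    rw [show q + d + 1 - q = d + 1 by omega, Nat.cast_sub (Nat.mul_le_mul (by omega) (by omega))]
    push_cast
    ring
  · refine Finset.product_subset_product ?_ ?_ <;>
    · intro i hi
      rw [Finset.mem_Ico] at hi
      rw [Finset.mem_range]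
      exact hi.2

/-- The reduced exponent of degree `s` with a given index. -/
def toReducedExp {s : ℕ} (a : reducedIndex q s) : ReducedExp q × ℕ :=
  (⟨a.1, (mem_reducedIndex.1 a.2).2⟩, s - max a.1.1 a.1.2)

theorem toReducedExp_injective {s : ℕ} : Function.Injective (toReducedExp (q := q) (s := s)) := by
  intro a b h
  have := congrArg (fun z : ReducedExp q × ℕ => z.1.1) h
  exact Subtype.ext this

theorem sum_spaceExp (a : ReducedExp q × ℕ) :
    ∑ i, spaceExp a i = max a.1.1.1 a.1.1.2 + a.2 := by
  simp [spaceExp, Fin.sum_univ_four]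
  omega

theorem linearIndependent_coordRing (hq : 2 ≤ q) (hc : c ≠ 0) :
    LinearIndependent K fun a : ReducedExp q × ℕ =>
      Ideal.Quotient.mkₐ K (spaceCurve hq hc).ideal (mon K (spaceExp a)) := by
  have h : ∀ f ∈ (spaceCurve hq hc).ideal, spacePoint q c f = 0 := by
    intro f hf
    rw [ideal_spaceCurve] at hf
    exact hf
  refine LinearIndependent.of_comp (Ideal.Quotient.liftₐ _ (spacePoint q c) h).toLinearMap ?_
  exact linearIndependent_spacePoint hq

/-- The reduction preserves degrees. A reduced monomial of degree `s` is determined by `(i, j)`,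
since the exponent of the last coordinate must be `s - max i j`. -/
theorem map_homogeneousSubmodule (hq : 2 ≤ q) (hc : c ≠ 0) (s : ℕ) :
    (homogeneousSubmodule (Fin 4) K s).map
      (Ideal.Quotient.mkₐ K (spaceCurve hq hc).ideal).toLinearMap =
      Submodule.span K (Set.range fun a : reducedIndex q s =>
        Ideal.Quotient.mkₐ K (spaceCurve hq hc).ideal (mon K (spaceExp (toReducedExp a)))) := by
  apply le_antisymm
  · rw [Submodule.map_le_iff_le_comap]
    intro f hf
    refine Submodule.span_le.2 ?_ (mem_span_mon_of_isHomogeneous hf)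
    rintro _ ⟨e, he, rfl⟩
    have he' : ∑ i, e i = s := he
    refine SetLike.le_def.1 (sup_le ?_ (Submodule.span_le.2 ?_)) (space_reduction (c := c) hq e)
    · intro g hg
      have hg' : g ∈ (spaceCurve hq hc).ideal := by
        rw [ideal_spaceCurve, ker_spacePoint hq]
        exact hg
      have h0 : Ideal.Quotient.mkₐ K (spaceCurve hq hc).ideal g = 0 :=
        Ideal.Quotient.eq_zero_iff_mem.2 hg'
      rw [Submodule.mem_comap, AlgHom.toLinearMap_apply, h0]
      exact Submodule.zero_mem _
    · rintro _ ⟨t, ⟨⟨a, rfl⟩, ht⟩, rfl⟩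
      rw [sum_spaceExp, he'] at ht
      refine Submodule.subset_span ⟨⟨a.1.1, mem_reducedIndex.2 ⟨?_, a.1.2⟩⟩, ?_⟩
      · omega
      · have ha : s - max a.1.1.1 a.1.1.2 = a.2 := by omega
        simp only [toReducedExp, ha, AlgHom.toLinearMap_apply]
  · rw [Submodule.span_le]
    rintro _ ⟨a, rfl⟩
    refine ⟨_, ?_, rfl⟩
    have h1 := isHomogeneous_mon (K := K) (spaceExp (toReducedExp a))
    rw [sum_spaceExp] at h1
    have h2 := (mem_reducedIndex.1 a.2).1
    have h3 : max (toReducedExp a).1.1.1 (toReducedExp a).1.1.2 + (toReducedExp a).2 = s := by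
      simp only [toReducedExp]
      omega
    rw [h3] at h1
    exact h1

theorem hasDegree_spaceCurve (hq : 2 ≤ q) (hc : c ≠ 0) :
    (spaceCurve hq hc).HasDegree (2 * q) := by
  refine ⟨2 * q - q ^ 2, Filter.eventually_atTop.2 ⟨q, fun s hs => ?_⟩⟩
  have hli := finrank_span_eq_card
    ((linearIndependent_coordRing hq hc).comp _ (toReducedExp_injective (s := s)))
  rw [Fintype.card_coe] at hli
  rw [ProjCurve.hilbertFunction, map_homogeneousSubmodule]
  refine (congrArg Nat.cast hli).trans ?_
  rw [card_reducedIndex hs]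
  push_cast
  ring

end Degree

/-! ### The Jacobian criterion for the space model. -/

section Nonsingular

variable {K : Type*} [Field K] {q : ℕ} {c : K}

theorem span_gradient_pair {n : ℕ} {F G : MvPolynomial (Fin n) K} {v : Fin n → K}
    (hF : eval v F = 0) (hG : eval v G = 0) :
    Submodule.span K {w : Fin n → K | ∃ f ∈ Ideal.span {F, G}, w = fun i => eval v (pderiv i f)} =
      Submodule.span K (Set.range ![fun i => eval v (pderiv i F), fun i => eval v (pderiv i G)])
    := by
  apply le_antisymm
  · rw [Submodule.span_le]
    rintro _ ⟨f, hf, rfl⟩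
    obtain ⟨a, b, rfl⟩ := Ideal.mem_span_pair.1 hf
    have : (fun i => eval v (pderiv i (a * F + b * G))) =
        eval v a • (fun i => eval v (pderiv i F)) + eval v b • fun i => eval v (pderiv i G) := by
      ext i
      simp [hF, hG]
    rw [this]
    exact Submodule.add_mem _ (Submodule.smul_mem _ _ (Submodule.subset_span ⟨0, rfl⟩))
      (Submodule.smul_mem _ _ (Submodule.subset_span ⟨1, rfl⟩))
  · refine Submodule.span_mono ?_
    rintro _ ⟨i, rfl⟩
    fin_cases i
    · exact ⟨F, Ideal.subset_span (by simp), rfl⟩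
    · exact ⟨G, Ideal.subset_span (by simp), rfl⟩

/-- Here `q = r + 2`, and `e0`-`e3` express a linear relation between the gradients of the two
equations, with `q - 1 = -1` in `K`. -/
theorem gradient_relation {r : ℕ} {X Y Z W s t : K} (hc : c ≠ 0)
    (hv : ¬ (X = 0 ∧ Y = 0 ∧ Z = 0 ∧ W = 0)) (hQ : X * Y = Z * W)
    (hS : Z ^ (r + 2) + (X ^ (r + 1) + Y ^ (r + 1) + W ^ (r + 1)) * Z = c * W ^ (r + 2))
    (e0 : s * Y = t * (X ^ r * Z)) (e1 : s * X = t * (Y ^ r * Z))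
    (e2 : s * W = t * (X ^ (r + 1) + Y ^ (r + 1) + W ^ (r + 1)))
    (e3 : s * Z = -(t * (W ^ r * Z))) : s = 0 ∧ t = 0 := by
  by_cases ht : t = 0
  · subst ht
    refine ⟨?_, rfl⟩
    by_contra hs
    simp only [zero_mul, mul_eq_zero, hs, false_or, neg_zero] at e0 e1 e2 e3
    exact hv ⟨e1, e0, e3, e2⟩
  exfalso
  by_cases hZ : Z = 0
  · subst hZ
    have hW : W = 0 := by
      have h1 : c * W ^ (r + 2) = 0 := by rw [← hS]; ring
      exact eq_zero_of_pow_eq_zero ((mul_eq_zero.1 h1).resolve_left hc)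
    subst hW
    have h2 : X ^ (r + 1) + Y ^ (r + 1) = 0 := by
      have h3 : t * (X ^ (r + 1) + Y ^ (r + 1)) = 0 := by linear_combination -e2
      exact (mul_eq_zero.1 h3).resolve_left ht
    rw [mul_zero] at hQ
    rcases mul_eq_zero.1 hQ with rfl | rfl
    · have : Y = 0 := by
        apply eq_zero_of_pow_eq_zero (n := r + 1)
        linear_combination h2
      exact hv ⟨rfl, this, rfl, rfl⟩
    · have : X = 0 := by
        apply eq_zero_of_pow_eq_zero (n := r + 1)
        linear_combination h2
      exact hv ⟨this, rfl, rfl, rfl⟩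
  · have hs : s = -(t * W ^ r) := by
      apply mul_right_cancel₀ hZ
      linear_combination e3
    subst hs
    -- Eliminating `s` forces `X^(q-1) = Y^(q-1) = -W^(q-1)`. The `(q-1)`-th power of the quadric
    -- equation and then the surface equation give `W = 0`, hence `Z = 0`.
    have h1 : X ^ (r + 1) = -W ^ (r + 1) := by
      apply mul_left_cancel₀ (mul_ne_zero ht hZ)
      linear_combination -X * e0 - t * W ^ r * hQ
    have h2 : Y ^ (r + 1) = -W ^ (r + 1) := by
      apply mul_left_cancel₀ (mul_ne_zero ht hZ)
      linear_combination -Y * e1 - t * W ^ r * hQ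
    have h3 : W ^ (r + 1) * (Z ^ (r + 1) - W ^ (r + 1)) = 0 := by
      have h4 := congrArg (· ^ (r + 1)) hQ
      simp only [mul_pow, h1, h2] at h4
      linear_combination -h4
    rw [h1, h2] at hS
    have hW : W = 0 := by
      rcases mul_eq_zero.1 h3 with h4 | h4
      · exact eq_zero_of_pow_eq_zero h4
      · have h5 : c * W ^ (r + 2) = 0 := by linear_combination -hS + Z * h4
        exact eq_zero_of_pow_eq_zero ((mul_eq_zero.1 h5).resolve_left hc)
    subst hW
    apply hZ
    apply eq_zero_of_pow_eq_zero (n := r + 2)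
    linear_combination hS

theorem isNonsingular_spaceCurve [IsAlgClosed K] (hq : 2 ≤ q) (hc : c ≠ 0) (hq0 : (q : K) = 0) :
    (spaceCurve hq hc).IsNonsingular := by
  intro v hv hY
  rw [carrier_spaceCurve] at hY
  have hQ : eval v (quadricForm K) = 0 := hY v hv rfl _ (by simp)
  have hS : eval v (surfaceForm q c) = 0 := hY v hv rfl _ (by simp)
  rw [ideal_spaceCurve, ker_spacePoint hq, span_gradient_pair hQ hS, finrank_span_eq_card]
  · simp
  obtain ⟨r, rfl⟩ := Nat.exists_eq_add_of_le' hq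
  have hr : (r : K) = -2 := by
    push_cast at hq0
    linear_combination hq0
  rw [LinearIndependent.pair_iff]
  intro s t hst
  have e0 := congrFun hst 0
  have e1 := congrFun hst 1
  have e2 := congrFun hst 2
  have e3 := congrFun hst 3
  simp [quadricForm, surfaceForm, pderiv_X, Pi.single_apply, hr] at hQ hS e0 e1 e2 e3
  refine gradient_relation (X := v 0) (Y := v 1) (Z := v 2) (W := v 3) (r := r) hc ?_ ?_ ?_ ?_ ?_
    ?_ ?_
  · rintro ⟨h0, h1, h2, h3⟩
    apply hv
    ext i
    fin_cases i
    exacts [h0, h1, h2, h3]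
  · linear_combination hQ
  · linear_combination hS
  · linear_combination e0
  · linear_combination e1
  · linear_combination -e2
  · linear_combination -e3

end Nonsingular

/-! ### Fields of definition. -/

section DefinedOver

variable {K : Type*} [Field K] {p k q : ℕ} {c : K}

theorem polyDefinedOver_iff [Fact p.Prime] [CharP K p] {n : ℕ}
    {f : MvPolynomial (Fin (n + 1)) K} :
    ProjCurve.PolyDefinedOver (p ^ k) f ↔ map (iterateFrobenius K p k) f = f := by
  rw [MvPolynomial.ext_iff]
  simp [ProjCurve.PolyDefinedOver, coeff_map, iterateFrobenius_def]

theorem isDefinedOver_planeCurve [IsAlgClosed K] [Fact p.Prime] [CharP K p] (hq : 2 ≤ q)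
    (hc : c ≠ 0) (hcp : c ^ p ^ k = c) : (planeCurve hq hc).IsDefinedOver (p ^ k) := by
  refine ⟨{asmForm q c}, ?_, rfl⟩
  rintro f rfl
  refine ⟨⟨_, isHomogeneous_asmForm hq⟩, polyDefinedOver_iff.2 ?_⟩
  simp [asmForm, iterateFrobenius_def, hcp]

theorem isDefinedOver_spaceCurve [IsAlgClosed K] [Fact p.Prime] [CharP K p] (hq : 2 ≤ q)
    (hc : c ≠ 0) (hcp : c ^ p ^ k = c) : (spaceCurve hq hc).IsDefinedOver (p ^ k) := by
  refine ⟨{quadricForm K, surfaceForm q c}, ?_, carrier_spaceCurve hq hc⟩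
  rintro f (rfl | rfl)
  · refine ⟨⟨_, isHomogeneous_quadricForm⟩, polyDefinedOver_iff.2 ?_⟩
    simp [quadricForm]
  · refine ⟨⟨_, isHomogeneous_surfaceForm hq⟩, polyDefinedOver_iff.2 ?_⟩
    simp [surfaceForm, iterateFrobenius_def, hcp]

theorem polyDefinedOver_asmTau [Fact p.Prime] [CharP K p] (i : Fin 4) :
    ProjCurve.PolyDefinedOver (p ^ k) (asmTau K i) := by
  rw [polyDefinedOver_iff]
  fin_cases i <;> simp [asmTau]

theorem polyDefinedOver_planes [Fact p.Prime] [CharP K p] {n : ℕ} (i : Fin (n + 1)) :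
    ProjCurve.PolyDefinedOver (p ^ k) (ProjCurve.planes K n i) := by
  rw [polyDefinedOver_iff]
  simp [ProjCurve.planes]

end DefinedOver

end ASM

/-! ### From the function field back to the curves. -/

namespace ProjCurve

variable {K : Type*} [Field K] {n p k q : ℕ} {c : K} {C : ProjCurve K n}
  {F : Fin 4 → MvPolynomial (Fin (n + 1)) K} {l : Fin (n + 1)} {x y : C.functionField}

theorem isOrderSequence_of_isASMField [Fact p.Prime] [CharP K p] (hk : k ≠ 0) (hq : q = p ^ k)
    (hc : c ≠ 0) (h3 : 3 ≤ q) (hF : ∃ d, ∀ i, (F i).IsHomogeneous d) (hl : X l ∉ C.ideal)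
    (h : IsASMField K q c x y) (hxy : ∀ i, C.dehom l (F i) = (![x, y, x * y, 1] : Fin 4 → _) i) :
    C.IsOrderSequence F ![0, 1, 2, q] := by
  obtain ⟨E, hE, hx⟩ := h.exists_hasseExpansion hc hk hq
  refine ⟨hF, l, hl, x, E, ⟨h.isSeparable hc hk hq, hE, hx⟩, ?_⟩
  simp only [hxy]
  exact h.isLexLeast_order hc hq hE hx h3

theorem isFrobeniusOrderSequence_of_isASMField [Fact p.Prime] [CharP K p] (hk : k ≠ 0)
    (hq : q = p ^ k) (hc : c ≠ 0) (h3 : 3 ≤ q) (hcq : c ^ q = c)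
    (hF : ∃ d, ∀ i, (F i).IsHomogeneous d) (hl : X l ∉ C.ideal)
    (h : IsASMField K q c x y) (hxy : ∀ i, C.dehom l (F i) = (![x, y, x * y, 1] : Fin 4 → _) i)
    (hC : C.IsDefinedOver (q ^ 2)) (hFQ : ∀ i, PolyDefinedOver (q ^ 2) (F i)) :
    C.IsFrobeniusOrderSequence (q ^ 2) F ![0, 1, q] := by
  obtain ⟨E, hE, hx⟩ := h.exists_hasseExpansion hc hk hq
  refine ⟨hC, hFQ, hF, l, hl, x, E, ⟨h.isSeparable hc hk hq, hE, hx⟩, ?_⟩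
  simp only [hxy]
  exact h.isLexLeast_frobenius hc hq hE hx h3 hcq

theorem IsOrderSequence.isNonclassical {F : Fin (3 + 1) → MvPolynomial (Fin (n + 1)) K}
    (h : C.IsOrderSequence F ![0, 1, 2, q]) (hq : q ≠ 3) : C.IsNonclassical F :=
  ⟨_, h, fun h0 => hq (congrFun h0 3)⟩

theorem IsFrobeniusOrderSequence.isFrobeniusNonclassical {Q : ℕ}
    {F : Fin (3 + 1) → MvPolynomial (Fin (n + 1)) K}
    (h : C.IsFrobeniusOrderSequence Q F ![0, 1, q]) (hq : q ≠ 2) :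
    C.IsFrobeniusNonclassical Q F :=
  ⟨_, h, fun h0 => hq (congrFun h0 2)⟩

end ProjCurve

theorem theorem1 {K : Type*} [Field K] [IsAlgClosed K] (p k q : ℕ) [Fact p.Prime] [CharP K p]
    (hk : k ≠ 0) (hq : q = p ^ k) (c : K) (hc : c ≠ 0) :
    ∃ (C : ProjCurve K 2) (Y : ProjCurve K 3),
      C.carrier = projZeroLocus {asmForm q c} ∧
      Y.carrier = projClosure (projImage (asmTau K) C.carrier) ∧
      C.IsBirationalVia Y (asmTau K) ∧
      Y.IsNonsingular ∧
      Y.HasDegree (2 * q) ∧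
      (5 ≤ q →
        (Y.IsNonclassical (ProjCurve.planes K 3) ∧
          Y.IsOrderSequence (ProjCurve.planes K 3) ![0, 1, 2, q]) ∧
        (C.IsNonclassical (asmTau K) ∧
          C.IsOrderSequence (asmTau K) ![0, 1, 2, q]) ∧
        (c ^ q = c →
          (Y.IsFrobeniusNonclassical (q ^ 2) (ProjCurve.planes K 3) ∧
            Y.IsFrobeniusOrderSequence (q ^ 2) (ProjCurve.planes K 3) ![0, 1, q]) ∧
          (C.IsFrobeniusNonclassical (q ^ 2) (asmTau K) ∧
            C.IsFrobeniusOrderSequence (q ^ 2) (asmTau K) ![0, 1, q]))) := by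
  have h2 : 2 ≤ q := by
    rw [hq]
    exact (Fact.out : p.Prime).two_le.trans (Nat.le_self_pow hk p)
  have hq0 : (q : K) = 0 := by
    rw [hq, Nat.cast_pow, CharP.cast_eq_zero, zero_pow hk]
  refine ⟨ASM.planeCurve h2 hc, ASM.spaceCurve h2 hc, rfl, rfl, ASM.isBirationalVia_asmTau h2 hc,
    ASM.isNonsingular_spaceCurve h2 hc hq0, ASM.hasDegree_spaceCurve h2 hc, fun h5 => ?_⟩
  have h3 : 3 ≤ q := by omega
  obtain ⟨x, y, hxy, hY⟩ := ASM.exists_isASMField_spaceCurve h2 hc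
  have hplanes : ∃ d, ∀ i, (ProjCurve.planes K 3 i).IsHomogeneous d := ⟨1, isHomogeneous_X K⟩
  have htau : ∃ d, ∀ i, (asmTau K i).IsHomogeneous d := ⟨2, ASM.isHomogeneous_asmTau⟩
  have hYo := ProjCurve.isOrderSequence_of_isASMField hk hq hc h3 hplanes
    (ASM.X_three_notMem_ideal h2 hc) hxy hY
  have hCo := ProjCurve.isOrderSequence_of_isASMField hk hq hc h3 htau
    (ASM.X_two_notMem_ideal h2 hc) (ASM.isASMField_planeCurve h2 hc) (ASM.dehom_asmTau h2 hc)
  refine ⟨⟨hYo.isNonclassical (by omega), hYo⟩, ⟨hCo.isNonclassical (by omega), hCo⟩,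
    fun hcq => ?_⟩
  have hQ : q ^ 2 = p ^ (k * 2) := by rw [hq, pow_mul]
  have hcQ : c ^ p ^ (k * 2) = c := by rw [← hQ, pow_two, pow_mul, hcq, hcq]
  have hYf := ProjCurve.isFrobeniusOrderSequence_of_isASMField hk hq hc h3 hcq hplanes
    (ASM.X_three_notMem_ideal h2 hc) hxy hY (hQ ▸ ASM.isDefinedOver_spaceCurve h2 hc hcQ)
    (hQ ▸ ASM.polyDefinedOver_planes)
  have hCf := ProjCurve.isFrobeniusOrderSequence_of_isASMField hk hq hc h3 hcq htau
    (ASM.X_two_notMem_ideal h2 hc) (ASM.isASMField_planeCurve h2 hc) (ASM.dehom_asmTau h2 hc)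
    (hQ ▸ ASM.isDefinedOver_planeCurve h2 hc hcQ) (hQ ▸ ASM.polyDefinedOver_asmTau)
  exact ⟨⟨hYf.isFrobeniusNonclassical (by omega), hYf⟩,
    ⟨hCf.isFrobeniusNonclassical (by omega), hCf⟩⟩
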